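/- **Setting.** Let $\Theta$ be a finite set of $n$ states, $\Delta(\Theta)$ the simplex of beliefs with (relative) interior $\operatorname{int}\Delta(\Theta)$, and $\mu\in\Delta(\Theta)$ a prior of full support. Let $\mathcal F(\mu)$ be the set of Bayes-plausible distributions, i.e. Borel probability measures on $\Delta(\Theta)$ with mean $\mu$. The principal has a nonempty compact action space $A$ and utility $u(a,\theta)$ continuous in $a$; put $V(\mathbf x)=\max_{a}\sum_\theta x_\theta u(a,\theta)$. Acquiring $F\in\mathcal F(\mu)$ costs the agent $C(F)=\kappa\int c\,dF$, where $\kappa>0$ and $c:\Delta(\Theta)\to\mathbb R_+$ is measurable, strictly convex, twice continuously differentiable and bounded on $\operatorname{int}\Delta(\Theta)$, with $c(\mu)=0$. The agent's utility of money $v$ is defined on an interval containing $0$, is continuously differentiable and strictly increasing, and $v(0)=0$. Her outside option is worth $v_0\ge 0$. A contract $(M,t)$ consists of a compact set $M$ of messages and a measurable transfer $t:M\times\Theta\to\mathbb R$ expressed in utils, with values in the range of $v$, and nonnegative if the agent is protected by limited liability (which may or may not be assumed). Under $(M,t)$ the agent chooses $G\in\mathcal F(\mu)$ and, for each posterior in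 $\operatorname{supp}(G)$, a lottery over sending a message $m\in M$ and walking away; at posterior $\mathbf x$ message $m$ gives her expected utility $\sum_\theta x_\theta t(m,\theta)$ and walking away gives $v_0$; her payoff is the expected utility minus $C(G)$. The contract *implements* $F\in\mathcal F(\mu)$ if $M=\operatorname{supp}(F)$ and it is optimal for the agent (among all strategies of well-defined finite expected utility, and against rejecting the contract for $v_0$) to acquire $F$ and always report the realized posterior. Its cost to the principal is then $\int\sum_\theta x_\theta\, v^{-1}(t(\mathbf x,\theta))\,dF(\mathbf x)$, an extended real number, taken to be $+\infty$ if the expectation does not exist; her payoff is $\int V\,dF$ minus this cost. A randomization over contracts *induces* $G$ if almost every realized contract $(M_\omega,t_\omega)$ implements some $F_\omega$ and $G$ is the average of the $F_\omega$ (everything being measurable in $\omega$); its cost is the expectation of the payments $v^{-1}(t_\omega(\mathbf x,\theta))$. **Corollary.** (i) Suppose $v$ is unbounded above. Then every $F\in\mathcal F(\mu)$ with $\operatorname{supp}(F)\subseteq\operatorname{int}\Delta(\Theta)$ can be induced at a finite cost: there is a contract that implements $F$ at a finite cost, and there is also a randomization over contracts, almost every one of which implements a distribution supported on at most $n$ points,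 that induces $F$ at a finite cost. (ii) Without loss of generality the principal induces only distributions supported on at most $n$ points. That is, if a contract $(M,t)$ implements $G\in\mathcal F(\mu)$, then - there is a randomization over contracts, almost every one of which implements a distribution supported on at most $n$ points, that induces $G$ at a cost no larger than that of $(M,t)$; and - for every real number $r$ not exceeding the principal's payoff from $(M,t)$ and $G$, there are a distribution $F\in\mathcal F(\mu)$ supported on at most $n$ points and a contract implementing $F$ that gives the principal a payoff of at least $r$. In particular, if her payoff from $(M,t)$ and $G$ is finite, some such $F$ and contract do at least as well. -/

import Mathlib

open MeasureTheory ProbabilityTheory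
open scoped ENNReal

universe u w

noncomputable section

namespace Delegation

/-- Beliefs about a finite set of states: the simplex `Δ(Θ)`. -/
abbrev Belief (Θ : Type u) [Fintype Θ] : Type u := stdSimplex ℝ Θ

/-- The (relative) interior of the simplex, as a set of vectors. -/
def openSimplex (Θ : Type u) [Fintype Θ] : Set (Θ → ℝ) :=
  {x | x ∈ stdSimplex ℝ Θ ∧ ∀ θ, 0 < x θ}

/-- The primitives of the model, with the standing assumptions on them. -/
structure Environment (Θ : Type u) [Fintype Θ] (A : Type w) [TopologicalSpace A] where
  /-- common prior, of full support -/
  prior : Belief Θ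
  prior_pos : ∀ θ, 0 < prior.1 θ
  /-- utility of the principal from an action in a state -/
  util : A → Θ → ℝ
  util_continuous : ∀ θ, Continuous fun a => util a θ
  /-- scale of the cost of information -/
  kappa : ℝ
  kappa_pos : 0 < kappa
  /-- cost of a posterior; only its values on the simplex matter -/
  c : (Θ → ℝ) → ℝ
  c_nonneg : ∀ x ∈ stdSimplex ℝ Θ, 0 ≤ c x
  c_measurable : Measurable fun x : Belief Θ => c x.1
  c_strictConvex : StrictConvexOn ℝ (stdSimplex ℝ Θ) c
  c_contDiff : ContDiffOn ℝ 2 c (openSimplex Θ)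
  c_bounded : ∃ B, ∀ x ∈ openSimplex Θ, c x ≤ B
  c_prior : c prior.1 = 0
  /-- amounts of money at which the agent's utility of money is defined: an interval containing 0
  (all of `ℝ`, or for instance `(-1, ∞)` for `v y = log (y + 1)`) -/
  money : Set ℝ
  money_interval : money.OrdConnected
  zero_mem_money : (0 : ℝ) ∈ money
  /-- utility of money of the agent -/
  v : ℝ → ℝ
  v_contDiff : ContDiffOn ℝ 1 v money
  v_strictMono : StrictMonoOn v money
  v_zero : v 0 = 0
  /-- outside option of the agent, in utils -/
  outside : ℝ
  outside_nonneg : 0 ≤ outside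
  /-- whether the agent is protected by limited liability -/
  limitedLiability : Prop

/-- A contract `(M, t)`: a compact set `M` of messages and a transfer, in utils, for every message
and state. Messages are labelled by beliefs; only the values of `transfer` on `messages` matter. -/
structure Contract (Θ : Type u) [Fintype Θ] where
  messages : Set (Belief Θ)
  messages_compact : IsCompact messages
  transfer : Belief Θ → Θ → ℝ
  transfer_measurable : ∀ θ, Measurable fun m => transfer m θ

/-- What the agent can do once she has seen her posterior: send a message (`Sum.inl m`), or walk
away with her outside option (`Sum.inr ()`). -/
abbrev Choice (Θ : Type u) [Fintype Θ] : Type u := Belief Θ ⊕ Unit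

/-- The choices available under a contract. -/
def Contract.choices {Θ : Type u} [Fintype Θ] (K : Contract Θ) : Set (Choice Θ) :=
  insert (Sum.inr ()) (Sum.inl '' K.messages)

/-- The strategy of reporting the realized posterior. -/
def truthful (Θ : Type u) [Fintype Θ] : Kernel (Belief Θ) (Choice Θ) :=
  Kernel.deterministic Sum.inl measurable_inl

/-- Expectation with values in the extended reals: expected positive part minus expected negative
part. If both are infinite the expectation does not exist; the value is then `⊤`, so that, for a
cost, a nonexistent expectation never counts as a low cost. -/
def extExpectation {X : Type*} [MeasurableSpace X] (ν : Measure X) (f : X → ℝ) : EReal :=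
  open Classical in
  if ∫⁻ x, ENNReal.ofReal (f x) ∂ν = ⊤ then ⊤
  else ((∫⁻ x, ENNReal.ofReal (f x) ∂ν : ℝ≥0∞) : EReal)
    - ((∫⁻ x, ENNReal.ofReal (-f x) ∂ν : ℝ≥0∞) : EReal)

namespace Environment

variable {Θ : Type u} [Fintype Θ] {A : Type w} [TopologicalSpace A]

/-- `F ∈ 𝓕(μ)`: a distribution over posteriors whose mean is the prior. -/
def BayesPlausible (E : Environment Θ A) (F : Measure (Belief Θ)) : Prop :=
  IsProbabilityMeasure F ∧ ∀ θ, ∫ x, x.1 θ ∂F = E.prior.1 θ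

/-- `C(F) = κ ∫ c dF`. -/
def learningCost (E : Environment Θ A) (F : Measure (Belief Θ)) : ℝ :=
  E.kappa * ∫ x, E.c x.1 ∂F

/-- Expected utils (gross of the cost of learning) of the agent from a choice at posterior `x`. -/
def grossUtility (E : Environment Θ A) (K : Contract Θ) (x : Belief Θ) : Choice Θ → ℝ
  | Sum.inl m => ∑ θ, x.1 θ * K.transfer m θ
  | Sum.inr _ => E.outside

/-- A strategy of the agent under the contract `K`: a Bayes-plausible distribution `G`, and for
every posterior in the support of `G` a lottery over the available choices. It has to have a
well-defined finite expected utility. -/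
def IsStrategy (E : Environment Θ A) (K : Contract Θ) (G : Measure (Belief Θ))
    (σ : Kernel (Belief Θ) (Choice Θ)) : Prop :=
  E.BayesPlausible G ∧ IsMarkovKernel σ ∧
    (∀ x ∈ G.support, ∀ᵐ d ∂(σ x), d ∈ K.choices) ∧
    Integrable (fun p : Belief Θ × Choice Θ => E.grossUtility K p.1 p.2) (G.compProd σ)

/-- The expected payoff of the agent from a strategy: expected utils minus the cost of learning. -/
def agentPayoff (E : Environment Θ A) (K : Contract Θ) (G : Measure (Belief Θ))
    (σ : Kernel (Belief Θ) (Choice Θ)) : ℝ :=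
  (∫ p, E.grossUtility K p.1 p.2 ∂(G.compProd σ)) - E.learningCost G

/-- `(G, σ)` is an optimal strategy of the agent. -/
def IsOptimalStrategy (E : Environment Θ A) (K : Contract Θ) (G : Measure (Belief Θ))
    (σ : Kernel (Belief Θ) (Choice Θ)) : Prop :=
  E.IsStrategy K G σ ∧
    ∀ G' σ', E.IsStrategy K G' σ' → E.agentPayoff K G' σ' ≤ E.agentPayoff K G σ

/-- Transfers have to be utility levels of some amount of money; under limited liability they
are nonnegative. -/
def Admissible (E : Environment Θ A) (K : Contract Θ) : Prop :=
  ∀ m ∈ K.messages, ∀ θ, K.transfer m θ ∈ E.v '' E.money ∧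
    (E.limitedLiability → 0 ≤ K.transfer m θ)

/-- The contract implements `F`: its messages are the points of the support of `F`, and it is
optimal for the agent to accept, to acquire `F` and always to report the realized posterior. -/
def Implements (E : Environment Θ A) (K : Contract Θ) (F : Measure (Belief Θ)) : Prop :=
  E.Admissible K ∧ K.messages = F.support ∧ E.IsOptimalStrategy K F (truthful Θ) ∧
    E.outside ≤ E.agentPayoff K F (truthful Θ)

/-- The inverse of the agent's utility of money. -/
def vInv (E : Environment Θ A) : ℝ → ℝ := Function.invFunOn E.v E.money

/-- Expected payment, in money, at posterior `x` if `x` is reported. -/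
def payment (E : Environment Θ A) (K : Contract Θ) (x : Belief Θ) : ℝ :=
  ∑ θ, x.1 θ * E.vInv (K.transfer x θ)

/-- Expected cost to the principal of the contract `K` when the agent acquires `F` and reports
truthfully. -/
def cost (E : Environment Θ A) (K : Contract Θ) (F : Measure (Belief Θ)) : EReal :=
  extExpectation F (E.payment K)

/-- `V(x)`: the principal's payoff from the best action at belief `x`. -/
def grossValue (E : Environment Θ A) (x : Belief Θ) : ℝ :=
  ⨆ a : A, ∑ θ, x.1 θ * E.util a θ

/-- Expected payoff of the principal when the contract `K` implements `F`. -/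
def principalPayoff (E : Environment Θ A) (K : Contract Θ) (F : Measure (Belief Θ)) : EReal :=
  ((∫ x, E.grossValue x ∂F : ℝ) : EReal) - E.cost K F

end Environment

/-- A randomization over contracts: the principal draws `ω` and offers `contract ω`; `dist ω` is
the distribution over posteriors meant to be acquired under it. -/
structure RandomContract (Θ : Type u) [Fintype Θ] where
  Ω : Type u
  [measurableSpace : MeasurableSpace Ω]
  prob : Measure Ω
  [isProbabilityMeasure : IsProbabilityMeasure prob]
  contract : Ω → Contract Θ
  transfer_measurable : ∀ θ, Measurable fun p : Ω × Belief Θ => (contract p.1).transfer p.2 θ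
  dist : Kernel Ω (Belief Θ)
  [isMarkovKernel : IsMarkovKernel dist]

attribute [instance] RandomContract.measurableSpace RandomContract.isProbabilityMeasure
  RandomContract.isMarkovKernel

namespace RandomContract

variable {Θ : Type u} [Fintype Θ] {A : Type w} [TopologicalSpace A]

/-- Almost every realized contract implements its distribution, and the resulting overall
distribution over posteriors is `G`. -/
def Induces (R : RandomContract Θ) (E : Environment Θ A) (G : Measure (Belief Θ)) : Prop :=
  (∀ᵐ ω ∂(R.prob), E.Implements (R.contract ω) (R.dist ω)) ∧ R.prob.bind R.dist = G

/-- Almost every realized contract comes with a distribution supported on at most `|Θ|` points. -/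
def SmallSupport (R : RandomContract Θ) : Prop :=
  ∀ᵐ ω ∂(R.prob), (R.dist ω).support.encard ≤ Fintype.card Θ

/-- Expected cost to the principal of the randomization. -/
def cost (R : RandomContract Θ) (E : Environment Θ A) : EReal :=
  extExpectation (R.prob.compProd R.dist) fun p => E.payment (R.contract p.1) p.2

end RandomContract

end Delegation

end

/-! Implementation is a supporting-hyperplane condition (`Supports`): some vector `l` makes the
affine function `∑ θ, x θ * l θ` plus `κ c(x)` bound the gross utility of every choice at every
belief, with equality for truthful reports almost surely. Since all admissible distributions have
the same mean, integrating this bound shows that it suffices (`Supports.implements`). Conversely,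
separating the prior from the net utilities of all (belief, choice) pairs yields `l`
(`Implements.exists_supports`). The condition is pointwise, so it survives decomposition of the
distribution. Any distribution with mean `μ` is a mixture of distributions on at most `|Θ|` points
with the same mean (`exists_mixture_of_splittings`, by the Riesz extension and Riesz-Markov
theorems). Almost every component is therefore implemented by the original transfers, with the same
`l`, on a smaller message set. Averaging the payments gives the original cost, so the mixture costs
exactly as much; and if every small component paid the principal less than `r`, so would the
average. For interior distributions the transfers are tangents of `κ c` raised by a constant. A
compact support in the interior keeps the tangents bounded, and an unbounded `v` makes these utility
levels available. -/

noncomputable section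

namespace Delegation

/-! ### Linear programming reduction and a supporting hyperplane -/

section SupportingHyperplane

variable {ι : Type*} {Θ : Type*} [Fintype Θ]

/-- The reduction step of linear programming: a conic combination of points of the hyperplane
`∑ θ, x θ = 1` can be supported on linearly independent points without decreasing the objective. -/
theorem exists_linearIndepOn_sum_le (x : ι → Θ → ℝ) (s : ι → ℝ) (hx : ∀ i, ∑ θ, x i θ = 1)
    (t : Finset ι) (w : ι → ℝ) (hw : ∀ i ∈ t, 0 ≤ w i) :
    ∃ (t' : Finset ι) (w' : ι → ℝ), (∀ i ∈ t', 0 < w' i) ∧ LinearIndepOn ℝ x (t' : Set ι) ∧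
      ∑ i ∈ t', w' i • x i = ∑ i ∈ t, w i • x i ∧ ∑ i ∈ t, w i * s i ≤ ∑ i ∈ t', w' i * s i := by
  classical
  induction t using Finset.strongInduction generalizing w with
  | H t ih =>
  by_cases h0 : ∃ i ∈ t, w i = 0
  · obtain ⟨i, hi, h0⟩ := h0
    obtain ⟨t', w', h1, h2, h3, h4⟩ := ih (t.erase i) (Finset.erase_ssubset hi) w
      fun j hj => hw j (Finset.mem_of_mem_erase hj)
    refine ⟨t', w', h1, h2, ?_, ?_⟩
    · rw [h3, ← Finset.add_sum_erase t _ hi, h0, zero_smul, zero_add]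
    · rwa [← Finset.add_sum_erase t _ hi, h0, zero_mul, zero_add]
  push Not at h0
  have hpos : ∀ i ∈ t, 0 < w i := fun i hi => (hw i hi).lt_of_ne' (h0 i hi)
  by_cases hli : LinearIndepOn ℝ x (t : Set ι)
  · exact ⟨t, w, hpos, hli, rfl, le_rfl⟩
  -- The sign of the linear relation is chosen so that moving the weights along it does not lower
  -- the objective.
  obtain ⟨a, ha, has, j, hj, haj⟩ : ∃ a : ι → ℝ, ∑ i ∈ t, a i • x i = 0 ∧
      0 ≤ ∑ i ∈ t, a i * s i ∧ ∃ i ∈ t, a i ≠ 0 := by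
    obtain ⟨a, ha, hne⟩ := not_linearIndepOn_finset_iff.1 hli
    rcases le_total 0 (∑ i ∈ t, a i * s i) with h | h
    · exact ⟨a, ha, h, hne⟩
    · refine ⟨-a, by simp [ha], by simpa using h, by simpa using hne⟩
  -- All points have coordinate sum one, so the coefficients of a relation sum to zero and some
  -- coefficient is negative.
  have hsum : ∑ i ∈ t, a i = 0 := by
    have := congrArg (fun y : Θ → ℝ => ∑ θ, y θ) ha
    simp only [Finset.sum_apply, Pi.smul_apply, smul_eq_mul, Pi.zero_apply,
      Finset.sum_const_zero] at this
    rw [Finset.sum_comm] at this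
    simpa [← Finset.mul_sum, hx] using this
  have hneg : (t.filter fun i => a i < 0).Nonempty := by
    by_contra hcon
    rw [Finset.not_nonempty_iff_eq_empty, Finset.filter_eq_empty_iff] at hcon
    exact haj ((Finset.sum_eq_zero_iff_of_nonneg fun i hi => not_lt.1 (hcon hi)).1 hsum j hj)
  obtain ⟨k, hk, hmin⟩ := Finset.exists_min_image _ (fun i => w i / (-a i)) hneg
  rw [Finset.mem_filter] at hk
  -- The ratio test: the largest step that keeps all weights nonnegative, at which the weight of `k`
  -- vanishes.
  set τ := w k / (-a k) with hτ
  have hτ0 : 0 ≤ τ := div_nonneg (hw k hk.1) (by linarith)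
  have hw2 : ∀ i ∈ t, 0 ≤ w i + τ * a i := by
    intro i hi
    rcases lt_or_ge (a i) 0 with h | h
    · have := (le_div_iff₀ (by linarith : 0 < -a i)).1 (hmin i (Finset.mem_filter.2 ⟨hi, h⟩))
      linarith
    · have := hw i hi
      positivity
  have hwk : w k + τ * a k = 0 := by
    rw [hτ]; field_simp [hk.2.ne]; simp
  obtain ⟨t', w', h1, h2, h3, h4⟩ := ih (t.erase k) (Finset.erase_ssubset hk.1)
    (fun i => w i + τ * a i) fun j hj => hw2 j (Finset.mem_of_mem_erase hj)
  refine ⟨t', w', h1, h2, ?_, ?_⟩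
  · have := Finset.add_sum_erase t (fun i => (w i + τ * a i) • x i) hk.1
    simp only [hwk, zero_smul, zero_add] at this
    rw [h3, this]
    simp_rw [add_smul, mul_smul]
    rw [Finset.sum_add_distrib, ← Finset.smul_sum, ha, smul_zero, add_zero]
  · have := Finset.add_sum_erase t (fun i => (w i + τ * a i) * s i) hk.1
    simp only [hwk, zero_mul, zero_add] at this
    rw [this] at h4
    refine le_trans ?_ h4
    simp_rw [add_mul, mul_assoc]
    rw [Finset.sum_add_distrib, ← Finset.mul_sum]
    have := mul_nonneg hτ0 has
    linarith

/-- A supporting hyperplane at `μ` of the concave envelope of the points `(x i, s i)`. -/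
theorem exists_supporting_hyperplane [Nonempty Θ] (x : ι → Θ → ℝ) (s : ι → ℝ)
    (hx : ∀ i, x i ∈ stdSimplex ℝ Θ) (vert : Θ → ι)
    (hvert : ∀ θ ϑ, x (vert θ) ϑ = open Classical in if ϑ = θ then 1 else 0) (μ : Θ → ℝ)
    (hμ : ∀ θ, 0 < μ θ) (P : ℝ)
    (hP : ∀ (t : Finset ι) (w : ι → ℝ), (∀ i ∈ t, 0 < w i) → LinearIndepOn ℝ x (t : Set ι) →
      ∑ i ∈ t, w i • x i = μ → ∑ i ∈ t, w i * s i ≤ P) :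
    ∃ l : Θ → ℝ, (∀ i, s i ≤ ∑ θ, x i θ * l θ) ∧ ∑ θ, μ θ * l θ ≤ P := by
  classical
  have hP' : ∀ (t : Finset ι) (w : ι → ℝ), (∀ i ∈ t, 0 ≤ w i) →
      ∑ i ∈ t, w i • x i = μ → ∑ i ∈ t, w i * s i ≤ P := by
    intro t w hw h
    obtain ⟨t', w', h1, h2, h3, h4⟩ := exists_linearIndepOn_sum_le x s (fun i => (hx i).2) t w hw
    exact h4.trans (hP t' w' h1 h2 (h3.trans h))
  -- The strict hypograph of the conic envelope. The slack `p.1 - ∑ w x` must be positive in every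
  -- coordinate and is filled with vertices; this strictness makes `S` open in the full space.
  set S : Set ((Θ → ℝ) × ℝ) := {p | ∃ (w : ι →₀ ℝ), (∀ i, 0 ≤ w i) ∧
      (∀ θ, (w.sum fun i a => a • x i) θ < p.1 θ) ∧
      p.2 < (w.sum fun i a => a * s i) + ∑ θ, (p.1 θ - (w.sum fun i a => a • x i) θ) * s (vert θ)}
    with hS
  have hopen : IsOpen S := by
    have : S = ⋃ w ∈ {w : ι →₀ ℝ | ∀ i, 0 ≤ w i}, {p : (Θ → ℝ) × ℝ |
        (∀ θ, (w.sum fun i a => a • x i) θ < p.1 θ) ∧ p.2 < (w.sum fun i a => a * s i) +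
          ∑ θ, (p.1 θ - (w.sum fun i a => a • x i) θ) * s (vert θ)} := by
      ext p
      simp only [hS, Set.mem_iUnion, Set.mem_ofPred_eq, exists_prop]
    rw [this]
    refine isOpen_biUnion fun w _ => IsOpen.and ?_ ?_
    · rw [Set.ofPred_forall]
      exact isOpen_iInter_of_finite fun θ => isOpen_lt (by fun_prop) (by fun_prop)
    · exact isOpen_lt (by fun_prop) (by fun_prop)
  have hsx : ∀ (w w' : ι →₀ ℝ) (a b : ℝ), ((a • w + b • w').sum fun i a => a • x i) =
      a • (w.sum fun i a => a • x i) + b • (w'.sum fun i a => a • x i) := by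
    intro w w' a b
    rw [Finsupp.sum_add_index' (by simp) (by simp [add_smul]), Finsupp.sum_smul_index (by simp),
      Finsupp.sum_smul_index (by simp), Finsupp.smul_sum, Finsupp.smul_sum]
    simp [mul_smul]
  have hss : ∀ (w w' : ι →₀ ℝ) (a b : ℝ), ((a • w + b • w').sum fun i a => a * s i) =
      a * (w.sum fun i a => a * s i) + b * (w'.sum fun i a => a * s i) := by
    intro w w' a b
    rw [Finsupp.sum_add_index' (by simp) (by simp [add_mul]), Finsupp.sum_smul_index (by simp),
      Finsupp.sum_smul_index (by simp), Finsupp.mul_sum, Finsupp.mul_sum]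
    simp [mul_assoc]
  have hconv : Convex ℝ S := by
    rintro p ⟨w, hw0, hw1, hw2⟩ q ⟨w', hw0', hw1', hw2'⟩ a b ha hb hab
    refine ⟨a • w + b • w', ?_, ?_, ?_⟩
    · intro i
      have := hw0 i
      have := hw0' i
      simp only [Finsupp.coe_add, Finsupp.coe_smul, Pi.add_apply, Pi.smul_apply, smul_eq_mul]
      positivity
    · intro θ
      rw [hsx]
      have h1 := hw1 θ
      have h2 := hw1' θ
      simp only [Prod.fst_add, Prod.smul_fst, Pi.add_apply, Pi.smul_apply, smul_eq_mul]
      rcases ha.eq_or_lt with rfl | ha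
      · obtain rfl : b = 1 := by linarith
        simpa using h2
      · have := mul_lt_mul_of_pos_left h1 ha
        have := mul_le_mul_of_nonneg_left h2.le hb
        linarith
    · rw [hsx, hss]
      have h3 : ∑ θ, ((a • p + b • q).1 θ - (a • (w.sum fun i a => a • x i) +
          b • (w'.sum fun i a => a • x i)) θ) * s (vert θ) =
          a * ∑ θ, (p.1 θ - (w.sum fun i a => a • x i) θ) * s (vert θ) +
          b * ∑ θ, (q.1 θ - (w'.sum fun i a => a • x i) θ) * s (vert θ) := by
        rw [Finset.mul_sum, Finset.mul_sum, ← Finset.sum_add_distrib]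
        refine Finset.sum_congr rfl fun θ _ => ?_
        simp only [Prod.fst_add, Prod.smul_fst, Pi.add_apply, Pi.smul_apply, smul_eq_mul]
        ring
      rw [h3]
      simp only [Prod.snd_add, Prod.smul_snd, smul_eq_mul]
      rcases ha.eq_or_lt with rfl | ha
      · obtain rfl : b = 1 := by linarith
        linarith
      · have := mul_lt_mul_of_pos_left hw2 ha
        have := mul_le_mul_of_nonneg_left hw2'.le hb
        linarith
  have hnot : (μ, P) ∉ S := by
    rintro ⟨w, hw0, hw1, hw2⟩
    dsimp only at hw1 hw2
    set y := w.sum fun i a => a • x i with hy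
    -- Filling the slack with vertices gives an exact representation of `μ`, whose value would
    -- exceed `P`.
    set w' : ι →₀ ℝ := w + ∑ θ, Finsupp.single (vert θ) (μ θ - y θ) with hw'
    have e1 : w'.sum (fun i a => a • x i) = μ := by
      rw [hw', Finsupp.sum_add_index' (by simp) (by simp [add_smul]),
        ← Finsupp.sum_finsetSum_index (by simp) (by simp [add_smul]), ← hy]
      have : ∀ θ, (Finsupp.single (vert θ) (μ θ - y θ)).sum (fun i a => a • x i) =
          (μ θ - y θ) • x (vert θ) := fun θ => Finsupp.sum_single_index (by simp)
      simp_rw [this]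
      ext ϑ
      simp [Finset.sum_apply, hvert]
    have e2 : w'.sum (fun i a => a * s i) =
        w.sum (fun i a => a * s i) + ∑ θ, (μ θ - y θ) * s (vert θ) := by
      rw [hw', Finsupp.sum_add_index' (by simp) (by simp [add_mul]),
        ← Finsupp.sum_finsetSum_index (by simp) (by simp [add_mul])]
      have : ∀ θ, (Finsupp.single (vert θ) (μ θ - y θ)).sum (fun i a => a * s i) =
          (μ θ - y θ) * s (vert θ) := fun θ => Finsupp.sum_single_index (by simp)
      simp_rw [this]
    have := hP' w'.support w' (fun i _ => by
      rw [hw', Finsupp.add_apply, Finsupp.finsetSum_apply]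
      refine add_nonneg (hw0 i) (Finset.sum_nonneg fun θ _ => ?_)
      rw [Finsupp.single_apply]
      split_ifs
      · linarith [hw1 θ]
      · exact le_rfl) e1
    change w'.sum (fun i a => a * s i) ≤ P at this
    linarith
  obtain ⟨f, hf⟩ := geometric_hahn_banach_open_point hconv hopen hnot
  set g : Θ → ℝ := fun θ => f (Pi.single θ 1, 0) with hg
  set b : ℝ := f (0, 1) with hb
  have hf' : ∀ y r, f (y, r) = ∑ θ, y θ * g θ + r * b := by
    intro y r
    have : (y, r) = ∑ θ, y θ • ((Pi.single θ 1 : Θ → ℝ), (0 : ℝ)) + r • ((0 : Θ → ℝ), (1 : ℝ)) := by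
      ext ϑ
      · simp [Prod.fst_sum, Finset.sum_apply, Pi.single_apply]
      · simp [Prod.snd_sum]
    rw [this, map_add, map_sum, map_smul]
    simp only [map_smul, smul_eq_mul, hg, hb]
  -- Any value strictly below that of splitting `μ` into vertices puts `(μ, r₀)` in `S`.
  set r₀ : ℝ := ∑ θ, μ θ * s (vert θ) - 1 with hr₀
  have hray : ∀ i, ∀ k : ℝ, 0 ≤ k → ∀ d : ℝ, 0 ≤ d → (μ + k • x i, r₀ + k * s i - d) ∈ S := by
    intro i k hk d hd
    refine ⟨Finsupp.single i k, fun j => ?_, fun θ => ?_, ?_⟩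
    · rw [Finsupp.single_apply]; split_ifs <;> simp [hk]
    · simpa using hμ θ
    · simp [hr₀]
      linarith
  have hbase : ∀ i, ∀ k : ℝ, 0 ≤ k → ∀ d : ℝ, 0 ≤ d →
      k * (∑ θ, x i θ * g θ + s i * b) - d * b + f (μ, r₀) ≤ f (μ, P) := by
    intro i k hk d hd
    have := (hf _ (hray i k hk d hd)).le
    refine le_trans (le_of_eq ?_) this
    rw [hf', hf']
    simp only [Pi.add_apply, Pi.smul_apply, smul_eq_mul, add_mul, Finset.sum_add_distrib,
      mul_assoc, ← Finset.mul_sum]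
    ring
  -- `S` recedes in the direction `(x i, s i)`, so a functional bounded above on `S` cannot increase
  -- along it.
  have hcone : ∀ i, ∑ θ, x i θ * g θ + s i * b ≤ 0 := by
    intro i
    by_contra! hcon
    obtain ⟨k, hk⟩ := exists_nat_gt ((f (μ, P) - f (μ, r₀)) / (∑ θ, x i θ * g θ + s i * b))
    have := hbase i k k.cast_nonneg 0 le_rfl
    rw [div_lt_iff₀ hcon] at hk
    linarith
  have hbpos : 0 < (P - r₀) * b := by
    have := hf (μ, r₀) ⟨0, by simp, by simpa using hμ, by simp [hr₀]⟩
    rw [hf', hf'] at this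
    linarith
  obtain ⟨θ₀⟩ := ‹Nonempty Θ›
  have hb0 : 0 < b := by
    refine lt_of_le_of_ne ?_ fun h => by simp [← h] at hbpos
    by_contra! hneg
    obtain ⟨d, hd⟩ := exists_nat_gt ((f (μ, P) - f (μ, r₀)) / (-b))
    have := hbase (vert θ₀) 0 le_rfl d d.cast_nonneg
    rw [div_lt_iff₀ (by linarith)] at hd
    linarith
  -- Scaling `(μ, r₀)` towards the origin stays in `S`, so the bound at `(μ, P)` cannot be negative.
  have hzero : 0 ≤ f (μ, P) := by
    by_contra! hneg
    have hsmall : ∀ ε : ℝ, 0 < ε → ε * f (μ, r₀) < f (μ, P) := by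
      intro ε hε
      have := hf (ε • (μ, r₀)) ⟨0, by simp, by simpa using fun θ => mul_pos hε (hμ θ), ?_⟩
      · rwa [map_smul, smul_eq_mul] at this
      · simp only [Prod.smul_mk, smul_eq_mul, Finsupp.sum_zero_index, Pi.smul_apply, Pi.zero_apply,
          sub_zero, zero_add, mul_assoc, ← Finset.mul_sum, hr₀]
        linarith
    have h1 := hsmall 1 one_pos
    have h2 := hsmall (f (μ, P) / (2 * f (μ, r₀)))
      (div_pos_of_neg_of_neg hneg (by linarith))
    have h3 : f (μ, P) / (2 * f (μ, r₀)) * f (μ, r₀) = f (μ, P) / 2 := by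
      field_simp [show f (μ, r₀) ≠ 0 by linarith]
    linarith
  have hdiv : ∀ y : Θ → ℝ, ∑ θ, y θ * (-g θ / b) = -(∑ θ, y θ * g θ) / b := by
    intro y
    rw [← Finset.sum_neg_distrib, Finset.sum_div]
    exact Finset.sum_congr rfl fun θ _ => by ring
  -- The hyperplane `f = 0`, solved for its last coordinate.
  refine ⟨fun θ => -g θ / b, fun i => ?_, ?_⟩
  · rw [hdiv, le_div_iff₀ hb0]
    linarith [hcone i]
  · rw [hdiv, div_le_iff₀ hb0]
    rw [hf'] at hzero
    linarith

end SupportingHyperplane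

/-! ### Decomposition into Bayes-plausible distributions on at most `|Θ|` points -/

section Splitting

variable {Θ : Type u} [Fintype Θ]

theorem continuous_belief_apply (θ : Θ) : Continuous fun x : Belief Θ => x.1 θ :=
  (continuous_apply θ).comp continuous_subtype_val

theorem measurable_belief_apply (θ : Θ) : Measurable fun x : Belief Θ => x.1 θ :=
  (continuous_belief_apply θ).measurable

theorem _root_.ContinuousMap.integrable_of_compactSpace {X : Type*} [TopologicalSpace X]
    [CompactSpace X] [MeasurableSpace X] [BorelSpace X] (ν : Measure X) [IsFiniteMeasure ν]
    (f : C(X, ℝ)) : Integrable f ν :=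
  f.continuous.integrable_of_hasCompactSupport (HasCompactSupport.of_compactSpace f)

theorem integral_bind_kernel {X Y : Type*} [MeasurableSpace X] [MeasurableSpace Y]
    (ν : Measure X) [SFinite ν] (η : Kernel X Y) [IsSFiniteKernel η] (f : Y → ℝ)
    (hf : Integrable f (ν.bind η)) :
    ∫ y, f y ∂(ν.bind η) = ∫ x, ∫ y, f y ∂(η x) ∂ν := by
  rw [← Measure.snd_compProd, Measure.snd] at hf ⊢
  rw [integral_map measurable_snd.aemeasurable hf.aestronglyMeasurable]
  exact Measure.integral_compProd (hf.comp_measurable measurable_snd)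

/-- A distribution over `|Θ|` beliefs, given by weights and atoms. -/
abbrev Splitting (Θ : Type u) [Fintype Θ] : Type u := Belief Θ × (Θ → Belief Θ)

/-- The distribution described by a splitting. -/
def splitKernel (Θ : Type u) [Fintype Θ] : Kernel (Splitting Θ) (Belief Θ) where
  toFun ω := ∑ i, ENNReal.ofReal (ω.1.1 i) • Measure.dirac (ω.2 i)
  measurable' := by
    refine Measure.measurable_of_measurable_coe _ fun s hs => ?_
    simp only [Measure.coe_finsetSum, Finset.sum_apply, Measure.smul_apply, smul_eq_mul]
    refine Finset.measurable_sum _ fun i _ => Measurable.mul ?_ ?_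
    · exact ENNReal.measurable_ofReal.comp
        ((measurable_pi_apply i).comp (measurable_subtype_coe.comp measurable_fst))
    · exact (Measure.measurable_coe hs).comp
        (Measure.measurable_dirac.comp ((measurable_pi_apply i).comp measurable_snd))

theorem splitKernel_apply (ω : Splitting Θ) :
    splitKernel Θ ω = ∑ i, ENNReal.ofReal (ω.1.1 i) • Measure.dirac (ω.2 i) := rfl

instance : IsMarkovKernel (splitKernel Θ) where
  isProbabilityMeasure ω := ⟨by
    simp only [splitKernel_apply, Measure.coe_finsetSum, Finset.sum_apply, Measure.smul_apply,
      measure_univ, smul_eq_mul, mul_one]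
    rw [← ENNReal.ofReal_sum_of_nonneg fun i _ => ω.1.2.1 i, ω.1.2.2, ENNReal.ofReal_one]⟩

theorem integrable_splitKernel (ω : Splitting Θ) (f : Belief Θ → ℝ) :
    Integrable f (splitKernel Θ ω) := by
  rw [splitKernel_apply]
  refine integrable_finsetSum_measure.2 fun i _ => ?_
  exact (integrable_dirac (by simp)).smul_measure ENNReal.ofReal_ne_top

theorem integral_splitKernel (ω : Splitting Θ) (f : Belief Θ → ℝ) :
    ∫ x, f x ∂(splitKernel Θ ω) = ∑ i, ω.1.1 i * f (ω.2 i) := by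
  rw [splitKernel_apply, integral_finsetSum_measure fun i _ =>
    (integrable_dirac (by simp)).smul_measure ENNReal.ofReal_ne_top]
  refine Finset.sum_congr rfl fun i _ => ?_
  rw [integral_smul_measure, integral_dirac, ENNReal.toReal_ofReal (ω.1.2.1 i), smul_eq_mul]

theorem support_splitKernel_encard_le (ω : Splitting Θ) :
    (splitKernel Θ ω).support.encard ≤ Fintype.card Θ := by
  have h : (splitKernel Θ ω).support ⊆ Set.range ω.2 := by
    refine Measure.support_subset_of_isClosed (Set.finite_range _).isClosed ?_
    rw [mem_ae_iff, splitKernel_apply]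
    simp
  refine (Set.encard_le_encard h).trans ?_
  rw [← Set.image_univ]
  refine (Set.encard_image_le _ _).trans ?_
  simp

/-- A continuous function whose mean is nonnegative under all splittings of `μ` has a nonnegative
mean under every distribution with mean `μ`. -/
theorem integral_nonneg_of_splitting (μ : Belief Θ) (hμ : ∀ θ, 0 < μ.1 θ)
    (G : Measure (Belief Θ)) [IsProbabilityMeasure G] (hG : ∀ θ, ∫ x, x.1 θ ∂G = μ.1 θ)
    (g : C(Belief Θ, ℝ))
    (hg : ∀ ω : Splitting Θ, (∀ θ, ∑ i, ω.1.1 i * (ω.2 i).1 θ = μ.1 θ) →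
      0 ≤ ∑ i, ω.1.1 i * g (ω.2 i)) :
    0 ≤ ∫ x, g x ∂G := by
  classical
  obtain ⟨θ₀⟩ : Nonempty Θ := by
    by_contra hne
    rw [not_nonempty_iff] at hne
    have := μ.2.2
    simp at this
  have : Nonempty Θ := ⟨θ₀⟩
  have hint : ∀ f : C(Belief Θ, ℝ), Integrable f G := fun f => f.integrable_of_compactSpace G
  have hcoord : ∀ θ, Integrable (fun x : Belief Θ => x.1 θ) G := fun θ =>
    hint ⟨fun x => x.1 θ, continuous_belief_apply θ⟩
  obtain ⟨l, hl, hl0⟩ := exists_supporting_hyperplane (ι := Belief Θ) (fun x => x.1)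
    (fun x => -g x) (fun x => x.2) (fun θ => ⟨Pi.single θ 1, single_mem_stdSimplex ℝ θ⟩)
    (fun θ ϑ => by simp [Pi.single_apply]) μ.1 hμ 0 (by
      intro t w hw hli hsum
      -- Linear independence in `Θ → ℝ` bounds the number of atoms; they are then indexed by `Θ`,
      -- padding with weight zero at the dummy atom `μ`.
      have hcard : Fintype.card t ≤ Fintype.card Θ := by
        simpa using hli.fintype_card_le_finrank
      obtain ⟨e⟩ := Function.Embedding.nonempty_of_card_le hcard
      set p : Θ → ℝ := Function.extend e (fun i => w i.1) 0 with hp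
      set y : Θ → Belief Θ := Function.extend e (fun i => i.1) (fun _ => μ) with hy
      have key : ∀ φ : Belief Θ → ℝ, ∑ i ∈ t, w i * φ i = ∑ θ, p θ * φ (y θ) := by
        intro φ
        rw [← Finset.sum_coe_sort]
        refine Finset.sum_of_injOn e e.injective.injOn (by simp) ?_ ?_
        · intro θ _ hθ
          rw [hp, Function.extend_apply' _ _ _ (by simpa using hθ)]
          simp
        · intro i _
          rw [hp, hy, e.injective.extend_apply, e.injective.extend_apply]
      have hp0 : ∀ θ, 0 ≤ p θ := by
        intro θ
        by_cases h : ∃ i, e i = θ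
        · obtain ⟨i, rfl⟩ := h
          rw [hp, e.injective.extend_apply]
          exact (hw _ i.2).le
        · rw [hp, Function.extend_apply' _ _ _ h]
          simp
      have hmean : ∀ θ, ∑ i ∈ t, w i * i.1 θ = μ.1 θ := by
        intro θ
        simpa using congrFun hsum θ
      have hp1 : ∑ θ, p θ = 1 := by
        have h1 := key fun _ => 1
        simp only [mul_one] at h1
        rw [← h1, ← μ.2.2]
        simp_rw [← hmean]
        rw [Finset.sum_comm]
        refine Finset.sum_congr rfl fun i _ => ?_
        rw [← Finset.mul_sum, i.2.2, mul_one]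
      have := hg (⟨p, hp0, hp1⟩, y) fun θ => by
        rw [← hmean θ, key fun x => x.1 θ]
      rw [key fun x => -g x]
      simpa using this)
  have h1 : ∫ x, -g x ∂G ≤ ∫ x : Belief Θ, ∑ θ, x.1 θ * l θ ∂G :=
    integral_mono (hint g).neg (integrable_finsetSum _ fun θ _ => (hcoord θ).mul_const _) hl
  rw [integral_neg, integral_finsetSum _ fun θ _ => (hcoord θ).mul_const _] at h1
  simp_rw [integral_mul_const, hG] at h1
  linarith

/-- The mean of a continuous function under a splitting, as a continuous function of the
splitting. -/
def splitMean (g : C(Belief Θ, ℝ)) : C(Splitting Θ, ℝ) where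
  toFun ω := ∑ i, ω.1.1 i * g (ω.2 i)
  continuous_toFun := by
    refine continuous_finsetSum _ fun i _ => ?_
    exact ((continuous_belief_apply i).comp continuous_fst).mul
      (g.continuous.comp ((continuous_apply i).comp continuous_snd))

theorem splitMean_apply (g : C(Belief Θ, ℝ)) (ω : Splitting Θ) :
    splitMean g ω = ∑ i, ω.1.1 i * g (ω.2 i) := rfl

/-- Every distribution of posteriors with mean `μ` is a mixture of distributions with mean `μ` that
are supported on at most `|Θ|` points. -/
theorem exists_mixture_of_splittings (μ : Belief Θ) (hμ : ∀ θ, 0 < μ.1 θ)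
    (G : Measure (Belief Θ)) [IsProbabilityMeasure G] (hG : ∀ θ, ∫ x, x.1 θ ∂G = μ.1 θ) :
    ∃ Λ : Measure (Splitting Θ), IsProbabilityMeasure Λ ∧
      (∀ᵐ ω ∂Λ, ∀ θ, ∑ i, ω.1.1 i * (ω.2 i).1 θ = μ.1 θ) ∧ Λ.bind (splitKernel Θ) = G := by
  set Z : Set (Splitting Θ) := {ω | ∀ θ, ∑ i, ω.1.1 i * (ω.2 i).1 θ = μ.1 θ} with hZ
  have hint : ∀ f : C(Belief Θ, ℝ), Integrable f G := fun f => f.integrable_of_compactSpace G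
  -- Integration against `G` is to be extended from pairs `(g, 0)` to a functional `Φ` nonnegative
  -- on this cone; `Φ (0, ·)` will be integration against `Λ`.
  let s : PointedCone ℝ (C(Belief Θ, ℝ) × C(Splitting Θ, ℝ)) :=
    { carrier := {q | ∀ ω ∈ Z, 0 ≤ splitMean q.1 ω + q.2 ω}
      add_mem' := by
        intro a b ha hb ω hω
        have h1 := ha ω hω
        have h2 := hb ω hω
        simp only [splitMean_apply, Prod.fst_add, Prod.snd_add, ContinuousMap.add_apply, mul_add,
          Finset.sum_add_distrib] at h1 h2 ⊢
        linarith
      zero_mem' := by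
        intro ω _
        simp [splitMean_apply]
      smul_mem' := by
        rintro ⟨c, hc⟩ a ha ω hω
        have h1 := mul_nonneg hc (ha ω hω)
        refine h1.trans_eq ?_
        change _ = splitMean (c • a.1) ω + (c • a.2) ω
        simp only [splitMean_apply, ContinuousMap.smul_apply, smul_eq_mul, mul_add, Finset.mul_sum,
          mul_left_comm] }
  let I : C(Belief Θ, ℝ) →ₗ[ℝ] ℝ :=
    { toFun := fun f => ∫ x, f x ∂G
      map_add' := fun f g => integral_add (hint f) (hint g)
      map_smul' := fun c f => integral_const_mul c f }
  let f : (C(Belief Θ, ℝ) × C(Splitting Θ, ℝ)) →ₗ.[ℝ] ℝ :=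
    { domain := LinearMap.ker (LinearMap.snd ℝ _ _)
      toFun := (I ∘ₗ LinearMap.fst ℝ _ _) ∘ₗ Submodule.subtype _ }
  obtain ⟨Φ, hΦ, hΦ0⟩ := riesz_extension s f (by
      rintro ⟨⟨g, h⟩, hq⟩ hqs
      obtain rfl : h = 0 := hq
      refine integral_nonneg_of_splitting μ hμ G hG g fun ω hω => ?_
      have := hqs ω hω
      simpa only [ContinuousMap.zero_apply, add_zero, splitMean_apply] using this) (by
      rintro ⟨g, h⟩
      refine ⟨⟨(ContinuousMap.const _ (‖splitMean g + h‖), 0), rfl⟩, fun ω _ => ?_⟩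
      have h1 := (abs_le.1 ((splitMean g + h).norm_coe_le_norm ω)).1
      simp only [ContinuousMap.add_apply] at h1
      have h2 : splitMean (ContinuousMap.const _ ‖splitMean g + h‖ + g) ω =
          ‖splitMean g + h‖ + splitMean g ω := by
        simp only [splitMean_apply, ContinuousMap.add_apply, ContinuousMap.const_apply, mul_add,
          Finset.sum_add_distrib, ← Finset.sum_mul, ω.1.2.2, one_mul]
      change 0 ≤ splitMean (ContinuousMap.const _ ‖splitMean g + h‖ + g) ω + (0 + h) ω
      rw [h2, zero_add]
      linarith)
  have hΦI : ∀ g, Φ (g, 0) = ∫ x, g x ∂G := fun g => hΦ ⟨(g, 0), rfl⟩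
  -- The pair `(g, -splitMean g)` and its negative both lie in the cone, so `Φ` vanishes on it.
  have hΦT : ∀ g, Φ (0, splitMean g) = ∫ x, g x ∂G := by
    intro g
    rw [← hΦI]
    have h1 := hΦ0 (g, -splitMean g) fun ω _ => by simp
    have h2 := hΦ0 (-g, splitMean g) fun ω _ => by simp [splitMean_apply]
    have e1 : (g, -splitMean g) = (g, 0) - (0, splitMean g) := by simp
    have e2 : (-g, splitMean g) = (0, splitMean g) - (g, 0) := by simp
    rw [e1, map_sub] at h1
    rw [e2, map_sub] at h2
    linarith
  let L : CompactlySupportedContinuousMap (Splitting Θ) ℝ →ₚ[ℝ] ℝ := PositiveLinearMap.mk₀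
    { toFun := fun h => Φ (0, h.toContinuousMap)
      map_add' := fun a b => by
        rw [← map_add]
        congr 1
        ext <;> simp
      map_smul' := fun c a => by
        rw [RingHom.id_apply, ← map_smul]
        congr 1
        ext <;> simp }
    (fun a ha => hΦ0 _ fun ω _ => by
      have := ha ω
      simpa [splitMean_apply] using this)
  set Λ := RealRMK.rieszMeasure L
  have hL : ∀ h : C(Splitting Θ, ℝ), ∫ ω, h ω ∂Λ = Φ (0, h) := fun h =>
    RealRMK.integral_rieszMeasure L ⟨h, HasCompactSupport.of_compactSpace _⟩
  have hLT : ∀ g : C(Belief Θ, ℝ), ∫ ω, splitMean g ω ∂Λ = ∫ x, g x ∂G := fun g =>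
    (hL _).trans (hΦT g)
  have hfin : IsFiniteMeasure Λ := ⟨isCompact_univ.measure_lt_top⟩
  have hprob : IsProbabilityMeasure Λ := by
    have := hLT (ContinuousMap.const _ 1)
    simp only [splitMean_apply, ContinuousMap.const_apply, mul_one] at this
    have h1 : ∀ ω : Splitting Θ, ∑ i, ω.1.1 i = 1 := fun ω => ω.1.2.2
    simp only [h1, integral_const, smul_eq_mul, mul_one, probReal_univ] at this
    exact ⟨by rwa [measureReal_def, ENNReal.toReal_eq_one_iff] at this⟩
  refine ⟨Λ, hprob, ?_, ?_⟩
  -- The function `φ` measures the failure of the mean condition. It vanishes on `Z`, so `(0, -φ)`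
  -- is in the cone and `∫ φ dΛ ≤ 0`.
  · let φ : C(Splitting Θ, ℝ) := ∑ θ, |splitMean ⟨fun x => x.1 θ, continuous_belief_apply θ⟩ -
      ContinuousMap.const _ (μ.1 θ)|
    have hφ : ∀ ω, φ ω = ∑ θ, |∑ i, ω.1.1 i * (ω.2 i).1 θ - μ.1 θ| := by
      intro ω
      simp [φ, ContinuousMap.sum_apply, splitMean_apply]
    have hφ0 : ∀ ω, 0 ≤ φ ω := fun ω => by
      rw [hφ]
      exact Finset.sum_nonneg fun _ _ => abs_nonneg _
    have h1 : ∫ ω, φ ω ∂Λ ≤ 0 := by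
      rw [hL]
      have := hΦ0 (0, -φ) fun ω hω => by
        have : φ ω = 0 := by
          rw [hφ]
          refine Finset.sum_eq_zero fun θ _ => ?_
          rw [hω θ, sub_self, abs_zero]
        simp [splitMean_apply, this]
      have e : ((0 : C(Belief Θ, ℝ)), -φ) = -(0, φ) := by simp
      rw [e, map_neg] at this
      linarith
    have h2 := (integral_eq_zero_iff_of_nonneg hφ0 (φ.integrable_of_compactSpace Λ)).1
      (le_antisymm h1 (integral_nonneg hφ0))
    filter_upwards [h2] with ω hω θ
    rw [Pi.zero_apply, hφ, Finset.sum_eq_zero_iff_of_nonneg fun _ _ => abs_nonneg _] at hω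
    have := hω θ (Finset.mem_univ θ)
    rw [abs_eq_zero] at this
    linarith
  · refine ext_of_forall_integral_eq_of_IsFiniteMeasure fun g => ?_
    rw [integral_bind_kernel Λ _ g (g.toContinuousMap.integrable_of_compactSpace _)]
    refine Eq.trans (integral_congr_ae (Filter.Eventually.of_forall fun ω => ?_))
      (hLT g.toContinuousMap)
    exact integral_splitKernel ω g

end Splitting

/-! ### Sufficiency of a supporting affine function -/

section Implementation

namespace Environment

variable {Θ : Type u} [Fintype Θ] {A : Type w} [TopologicalSpace A]

/-- A belief is the convex combination of the vertices weighted by its own coordinates, so convexity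
bounds `c` on the boundary as well. -/
theorem c_le_sum_vertices (E : Environment Θ A) [DecidableEq Θ] (x : Belief Θ) :
    E.c x.1 ≤ ∑ θ, |E.c (Pi.single θ 1)| := by
  have h := E.c_strictConvex.convexOn.map_sum_le (t := Finset.univ) (w := x.1)
    (p := fun θ => Pi.single θ (1 : ℝ)) (fun θ _ => x.2.1 θ) x.2.2
    fun θ _ => single_mem_stdSimplex ℝ θ
  have hx : ∑ θ, x.1 θ • Pi.single θ (1 : ℝ) = x.1 := by
    ext ϑ
    simp [Finset.sum_apply, Pi.single_apply]
  rw [hx] at h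
  refine h.trans (Finset.sum_le_sum fun θ _ => ?_)
  rw [smul_eq_mul]
  have h1 : x.1 θ ≤ 1 := by
    rw [← x.2.2]
    exact Finset.single_le_sum (fun i _ => x.2.1 i) (Finset.mem_univ θ)
  calc x.1 θ * E.c (Pi.single θ 1) ≤ x.1 θ * |E.c (Pi.single θ 1)| :=
        mul_le_mul_of_nonneg_left (le_abs_self _) (x.2.1 θ)
    _ ≤ 1 * |E.c (Pi.single θ 1)| := mul_le_mul_of_nonneg_right h1 (abs_nonneg _)
    _ = _ := one_mul _

theorem exists_c_le (E : Environment Θ A) : ∃ B, ∀ x : Belief Θ, E.c x.1 ≤ B := by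
  classical
  exact ⟨_, E.c_le_sum_vertices⟩

theorem integrable_c (E : Environment Θ A) (F : Measure (Belief Θ)) [IsFiniteMeasure F] :
    Integrable (fun x : Belief Θ => E.c x.1) F := by
  obtain ⟨B, hB⟩ := E.exists_c_le
  refine Integrable.of_bound E.c_measurable.aestronglyMeasurable B (ae_of_all _ fun x => ?_)
  rw [Real.norm_of_nonneg (E.c_nonneg x.1 x.2)]
  exact hB x

theorem integrable_linear (l : Θ → ℝ) (F : Measure (Belief Θ)) [IsFiniteMeasure F] :
    Integrable (fun x : Belief Θ => ∑ θ, x.1 θ * l θ) F :=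
  integrable_finsetSum _ fun θ _ =>
    (ContinuousMap.integrable_of_compactSpace F ⟨_, continuous_belief_apply θ⟩).mul_const _

theorem BayesPlausible.integral_linear {E : Environment Θ A} {F : Measure (Belief Θ)}
    (hF : E.BayesPlausible F) (l : Θ → ℝ) :
    ∫ x, ∑ θ, x.1 θ * l θ ∂F = ∑ θ, E.prior.1 θ * l θ := by
  have := hF.1
  have hint : ∀ θ, Integrable (fun x : Belief Θ => x.1 θ * l θ) F := fun θ =>
    (ContinuousMap.integrable_of_compactSpace F ⟨_, continuous_belief_apply θ⟩).mul_const _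
  rw [integral_finsetSum _ fun θ _ => hint θ]
  simp_rw [integral_mul_const, hF.2]

theorem measurable_grossUtility (E : Environment Θ A) (K : Contract Θ) :
    Measurable fun p : Belief Θ × Choice Θ => E.grossUtility K p.1 p.2 := by
  have h : Measurable fun p : (Belief Θ × Belief Θ) ⊕ (Belief Θ × Unit) =>
      (Sum.elim (fun q => ∑ θ, q.1.1 θ * K.transfer q.2 θ) (fun _ => E.outside) p : ℝ) := by
    refine Measurable.sumElim ?_ measurable_const
    exact Finset.measurable_sum _ fun θ _ =>
      ((measurable_belief_apply θ).comp measurable_fst).mul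
        ((K.transfer_measurable θ).comp measurable_snd)
  convert h.comp (MeasurableEquiv.prodSumDistrib (Belief Θ) (Belief Θ) Unit).measurable using 1
  ext ⟨x, d | d⟩ <;> rfl

theorem measurable_report : Measurable fun x : Belief Θ => (x, (Sum.inl x : Choice Θ)) :=
  measurable_id.prodMk measurable_inl

theorem measurableSet_choices (K : Contract Θ) : MeasurableSet K.choices := by
  have h : K.choices = Sum.inr '' Set.univ ∪ Sum.inl '' K.messages := by
    ext d
    rcases d with d | d <;> simp [Contract.choices]
  rw [h]
  exact (measurableSet_inr_image.2 MeasurableSet.univ).union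
    (measurableSet_inl_image.2 K.messages_compact.isClosed.measurableSet)

theorem compProd_truthful (F : Measure (Belief Θ)) [SFinite F] :
    F.compProd (truthful Θ) = F.map fun x => (x, Sum.inl x) :=
  Measure.compProd_deterministic measurable_inl

theorem integral_truthful (E : Environment Θ A) (K : Contract Θ) (F : Measure (Belief Θ))
    [SFinite F] : ∫ p, E.grossUtility K p.1 p.2 ∂(F.compProd (truthful Θ)) =
      ∫ x, ∑ θ, x.1 θ * K.transfer x θ ∂F := by
  rw [compProd_truthful, integral_map measurable_report.aemeasurable
    (E.measurable_grossUtility K).aestronglyMeasurable]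
  rfl

/-- The affine function `l` supports the contract `K` at the distribution `F`: up to the cost of
information it bounds the utility from all choices at all beliefs, and is attained by reporting
truthfully almost surely under `F`. -/
structure Supports (E : Environment Θ A) (K : Contract Θ) (F : Measure (Belief Θ))
    (l : Θ → ℝ) : Prop where
  transfer_le : ∀ m ∈ K.messages, ∀ x : Belief Θ,
    ∑ θ, x.1 θ * K.transfer m θ ≤ ∑ θ, x.1 θ * l θ + E.kappa * E.c x.1
  outside_le : ∀ x : Belief Θ, E.outside ≤ ∑ θ, x.1 θ * l θ + E.kappa * E.c x.1
  eq_ae : ∀ᵐ x ∂F, ∑ θ, x.1 θ * K.transfer x θ = ∑ θ, x.1 θ * l θ + E.kappa * E.c x.1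

theorem Supports.agentPayoff_truthful {E : Environment Θ A} {K : Contract Θ}
    {F : Measure (Belief Θ)} {l : Θ → ℝ} (h : E.Supports K F l) (hF : E.BayesPlausible F) :
    E.agentPayoff K F (truthful Θ) = ∑ θ, E.prior.1 θ * l θ := by
  have := hF.1
  rw [agentPayoff, integral_truthful, integral_congr_ae h.eq_ae,
    integral_add (integrable_linear l F) ((E.integrable_c F).const_mul _), integral_const_mul,
    hF.integral_linear, learningCost, add_sub_cancel_right]

/-- Integrating the pointwise bound, the term `κ c` cancels the learning cost, and the linear part
depends on `G` only through its mean. -/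
theorem Supports.agentPayoff_le {E : Environment Θ A} {K : Contract Θ}
    {F G : Measure (Belief Θ)} {l : Θ → ℝ} (h : E.Supports K F l)
    {σ : Kernel (Belief Θ) (Choice Θ)} (hG : E.IsStrategy K G σ) :
    E.agentPayoff K G σ ≤ ∑ θ, E.prior.1 θ * l θ := by
  obtain ⟨hG1, hσ, hch, hint⟩ := hG
  have := hG1.1
  have hb : Integrable (fun x : Belief Θ => ∑ θ, x.1 θ * l θ + E.kappa * E.c x.1) G :=
    (integrable_linear l G).add ((E.integrable_c G).const_mul _)
  have hfst : G = (G.compProd σ).map Prod.fst := (Measure.fst_compProd G σ).symm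
  have hb' : Integrable (fun p : Belief Θ × Choice Θ =>
      ∑ θ, p.1.1 θ * l θ + E.kappa * E.c p.1.1) (G.compProd σ) := by
    rw [hfst] at hb
    exact hb.comp_measurable measurable_fst
  have hle : ∫ p, E.grossUtility K p.1 p.2 ∂(G.compProd σ) ≤
      ∫ p : Belief Θ × Choice Θ, (∑ θ, p.1.1 θ * l θ + E.kappa * E.c p.1.1) ∂(G.compProd σ) := by
    refine integral_mono_ae hint hb' (Measure.ae_compProd_of_ae_ae ?_ ?_)
    · refine measurableSet_le (E.measurable_grossUtility K) ?_
      refine Measurable.comp (g := fun x : Belief Θ => ∑ θ, x.1 θ * l θ + E.kappa * E.c x.1) ?_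
        measurable_fst
      exact (Finset.measurable_sum _ fun θ _ => (measurable_belief_apply θ).mul_const _).add
        (E.c_measurable.const_mul _)
    · filter_upwards [G.support_mem_ae] with x hx
      filter_upwards [hch x hx] with d hd
      rcases hd with rfl | ⟨m, hm, rfl⟩
      · exact h.outside_le x
      · exact h.transfer_le m hm x
  have heq : ∫ p : Belief Θ × Choice Θ, (∑ θ, p.1.1 θ * l θ + E.kappa * E.c p.1.1)
      ∂(G.compProd σ) = ∫ x : Belief Θ, (∑ θ, x.1 θ * l θ + E.kappa * E.c x.1) ∂G := by
    conv_rhs => rw [hfst]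
    rw [integral_map measurable_fst.aemeasurable]
    rw [← hfst]
    exact hb.aestronglyMeasurable
  rw [heq, integral_add (integrable_linear l G) ((E.integrable_c G).const_mul _),
    integral_const_mul, hG1.integral_linear] at hle
  rw [agentPayoff, learningCost]
  linarith

theorem Supports.implements {E : Environment Θ A} {K : Contract Θ} {F : Measure (Belief Θ)}
    {l : Θ → ℝ} (h : E.Supports K F l) (hK : E.Admissible K) (hm : K.messages = F.support)
    (hF : E.BayesPlausible F) : E.Implements K F := by
  have := hF.1
  have hpay := h.agentPayoff_truthful hF
  refine ⟨hK, hm, ⟨⟨hF, inferInstanceAs (IsMarkovKernel (Kernel.deterministic _ _)), ?_, ?_⟩, ?_⟩,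
    ?_⟩
  · intro x hx
    rw [truthful, Kernel.deterministic_apply]
    refine (ae_dirac_iff (p := (· ∈ K.choices)) (measurableSet_choices K)).2 ?_
    exact Or.inr ⟨x, hm ▸ hx, rfl⟩
  · rw [compProd_truthful, integrable_map_measure
      (E.measurable_grossUtility K).aestronglyMeasurable
      measurable_report.aemeasurable]
    refine ((integrable_linear l F).add ((E.integrable_c F).const_mul E.kappa)).congr ?_
    filter_upwards [h.eq_ae] with x hx
    exact hx.symm
  · intro G σ hG
    rw [hpay]
    exact h.agentPayoff_le hG
  -- Acceptance is the outside-option bound at the prior, where `c` is zero.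
  · rw [hpay]
    simpa [E.c_prior] using h.outside_le E.prior

end Environment

end Implementation

/-! ### Necessity of a supporting affine function -/

section Necessity

namespace Environment

variable {Θ : Type u} [Fintype Θ] {A : Type w} [TopologicalSpace A]

theorem integral_sum_dirac {ι X : Type*} [MeasurableSpace X] [MeasurableSingletonClass X]
    (t : Finset ι) (w : ι → ℝ) (hw : ∀ i ∈ t, 0 ≤ w i) (x : ι → X) (f : X → ℝ) :
    ∫ y, f y ∂(∑ i ∈ t, ENNReal.ofReal (w i) • Measure.dirac (x i)) = ∑ i ∈ t, w i * f (x i) := by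
  rw [integral_finsetSum_measure fun i _ =>
    (integrable_dirac (by simp)).smul_measure ENNReal.ofReal_ne_top]
  refine Finset.sum_congr rfl fun i hi => ?_
  rw [integral_smul_measure, integral_dirac, ENNReal.toReal_ofReal (hw i hi), smul_eq_mul]

theorem integrable_sum_dirac {ι X : Type*} [MeasurableSpace X] [MeasurableSingletonClass X]
    (t : Finset ι) (w : ι → ℝ) (x : ι → X) (f : X → ℝ) :
    Integrable f (∑ i ∈ t, ENNReal.ofReal (w i) • Measure.dirac (x i)) :=
  integrable_finsetSum_measure.2 fun _ _ =>
    (integrable_dirac (by simp)).smul_measure ENNReal.ofReal_ne_top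

/-- A finitely supported strategy with distinct posteriors pays the agent at most what she gets
from an optimal strategy. -/
theorem IsOptimalStrategy.sum_le {E : Environment Θ A} {K : Contract Θ} {F : Measure (Belief Θ)}
    {σ : Kernel (Belief Θ) (Choice Θ)} (h : E.IsOptimalStrategy K F σ)
    (t : Finset {p : Belief Θ × Choice Θ // p.2 ∈ K.choices})
    (w : {p : Belief Θ × Choice Θ // p.2 ∈ K.choices} → ℝ) (hw : ∀ i ∈ t, 0 < w i)
    (hinj : Set.InjOn (fun i => i.1.1) (t : Set {p : Belief Θ × Choice Θ // p.2 ∈ K.choices}))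
    (hsum : ∑ i ∈ t, w i • i.1.1.1 = E.prior.1) :
    ∑ i ∈ t, w i * (E.grossUtility K i.1.1 i.1.2 - E.kappa * E.c i.1.1.1) ≤
      E.agentPayoff K F σ := by
  classical
  have hmean : ∀ θ, ∑ i ∈ t, w i * i.1.1.1 θ = E.prior.1 θ := fun θ => by
    simpa using congrFun hsum θ
  have hw1 : ∑ i ∈ t, w i = 1 := by
    rw [← E.prior.2.2]
    simp_rw [← hmean]
    rw [Finset.sum_comm]
    refine Finset.sum_congr rfl fun i _ => ?_
    rw [← Finset.mul_sum, i.1.1.2.2, mul_one]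
  -- Distinct posteriors make the choice a function of the posterior. Walking away, always
  -- available, is the default off the atoms, so `sel` differs from a constant only on a finite set.
  let sel : Belief Θ → Choice Θ := fun b =>
    if hb : ∃ i ∈ t, i.1.1 = b then hb.choose.1.2 else Sum.inr ()
  have hsel : ∀ i ∈ t, sel i.1.1 = i.1.2 := by
    intro i hi
    have hb : ∃ j ∈ t, j.1.1 = i.1.1 := ⟨i, hi, rfl⟩
    have : hb.choose = i := hinj hb.choose_spec.1 hi hb.choose_spec.2
    simp only [sel, dif_pos hb, this]
  have hselmem : ∀ b, sel b ∈ K.choices := by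
    intro b
    by_cases hb : ∃ i ∈ t, i.1.1 = b
    · simp only [sel, dif_pos hb]
      exact hb.choose.2
    · simp only [sel, dif_neg hb]
      exact Or.inl rfl
  have hselmeas : Measurable sel := by
    refine (measurable_const (a := (Sum.inr () : Choice Θ))).measurable_of_countable_ne ?_
    refine Set.Countable.mono (s₂ := ((t.image fun i => i.1.1 : Finset (Belief Θ)) : Set _)) ?_
      (Finset.countable_toSet _)
    intro b hb
    by_contra hcon
    refine hb ?_
    have : ¬ ∃ i ∈ t, i.1.1 = b := by simpa using hcon
    simp only [sel, dif_neg this]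
  set G : Measure (Belief Θ) := ∑ i ∈ t, ENNReal.ofReal (w i) • Measure.dirac i.1.1 with hG
  have hGi : ∀ f : Belief Θ → ℝ, ∫ y, f y ∂G = ∑ i ∈ t, w i * f i.1.1 := fun f =>
    integral_sum_dirac t w (fun i hi => (hw i hi).le) _ f
  have hprob : IsProbabilityMeasure G := ⟨by
    simp only [hG, Measure.coe_finsetSum, Finset.sum_apply, Measure.smul_apply, measure_univ,
      smul_eq_mul, mul_one]
    rw [← ENNReal.ofReal_sum_of_nonneg fun i hi => (hw i hi).le, hw1, ENNReal.ofReal_one]⟩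
  have hmeas : Measurable fun x : Belief Θ => (x, sel x) := measurable_id.prodMk hselmeas
  have hstrat : E.IsStrategy K G (Kernel.deterministic sel hselmeas) := by
    refine ⟨⟨hprob, fun θ => ?_⟩, inferInstance, fun x _ => ?_, ?_⟩
    · rw [hGi, hmean]
    · rw [Kernel.deterministic_apply]
      exact (ae_dirac_iff (p := (· ∈ K.choices)) (measurableSet_choices K)).2 (hselmem x)
    · rw [Measure.compProd_deterministic, integrable_map_measure
        (E.measurable_grossUtility K).aestronglyMeasurable hmeas.aemeasurable]
      exact integrable_sum_dirac t w _ _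
  have hle := h.2 _ _ hstrat
  refine le_trans (le_of_eq ?_) hle
  rw [agentPayoff, Measure.compProd_deterministic, integral_map hmeas.aemeasurable
    (E.measurable_grossUtility K).aestronglyMeasurable, hGi, learningCost, hGi, Finset.mul_sum,
    ← Finset.sum_sub_distrib]
  refine Finset.sum_congr rfl fun i hi => ?_
  rw [hsel i hi]
  ring

/-- Optimality says that no finite strategy with distinct posteriors beats truth-telling. Linearly
independent posteriors are distinct, so this is enough for a supporting hyperplane at the prior to
the net utilities of all available choices. -/
theorem Implements.exists_supports {E : Environment Θ A} {K : Contract Θ}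
    {F : Measure (Belief Θ)} (h : E.Implements K F) : ∃ l, E.Supports K F l := by
  classical
  obtain ⟨hK, hm, hopt, hout⟩ := h
  obtain ⟨⟨hF, -, -, hint⟩, -⟩ := id hopt
  have := hF.1
  have : Nonempty Θ := by
    by_contra hne
    rw [not_nonempty_iff] at hne
    simpa using E.prior.2.2
  obtain ⟨l, hl, hl0⟩ := exists_supporting_hyperplane
    (ι := {p : Belief Θ × Choice Θ // p.2 ∈ K.choices}) (fun i => i.1.1.1)
    (fun i => E.grossUtility K i.1.1 i.1.2 - E.kappa * E.c i.1.1.1) (fun i => i.1.1.2)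
    (fun θ => ⟨(⟨Pi.single θ 1, single_mem_stdSimplex ℝ θ⟩, Sum.inr ()), Or.inl rfl⟩)
    (fun θ ϑ => by simp [Pi.single_apply]) E.prior.1 E.prior_pos (E.agentPayoff K F (truthful Θ))
    (fun t w hw hli hsum => hopt.sum_le t w hw
      (fun i hi j hj hij => hli.injOn hi hj (congrArg Subtype.val hij)) hsum)
  have htr : ∀ m ∈ K.messages, ∀ x : Belief Θ,
      ∑ θ, x.1 θ * K.transfer m θ ≤ ∑ θ, x.1 θ * l θ + E.kappa * E.c x.1 := by
    intro m hm' x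
    have := hl ⟨(x, Sum.inl m), Or.inr ⟨m, hm', rfl⟩⟩
    simp only [grossUtility] at this
    linarith
  refine ⟨l, htr, fun x => ?_, ?_⟩
  · have := hl ⟨(x, Sum.inr ()), Or.inl rfl⟩
    simp only [grossUtility] at this
    linarith
  · rw [compProd_truthful, integrable_map_measure
      (E.measurable_grossUtility K).aestronglyMeasurable
      measurable_report.aemeasurable] at hint
    have hint' : Integrable (fun x : Belief Θ => ∑ θ, x.1 θ * K.transfer x θ) F := hint
    have hb : Integrable (fun x : Belief Θ => ∑ θ, x.1 θ * l θ + E.kappa * E.c x.1) F :=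
      (integrable_linear l F).add ((E.integrable_c F).const_mul _)
    have hle : (fun x : Belief Θ => ∑ θ, x.1 θ * K.transfer x θ) ≤ᵐ[F]
        fun x => ∑ θ, x.1 θ * l θ + E.kappa * E.c x.1 := by
      filter_upwards [F.support_mem_ae] with x hx
      exact htr x (hm ▸ hx) x
    -- The hyperplane at the prior is no higher than the truthful payoff, so the integrals agree and
    -- the pointwise bound is tight almost surely.
    refine (integral_eq_iff_of_ae_le hint' hb hle).1 (le_antisymm (integral_mono_ae hint' hb hle) ?_)
    rw [integral_add (integrable_linear l F) ((E.integrable_c F).const_mul _), integral_const_mul,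
      hF.integral_linear]
    rw [agentPayoff, integral_truthful, learningCost] at hl0
    linarith

end Environment

end Necessity

/-! ### Replacing a distribution by its components -/

section Mixture

theorem extExpectation_eq_integral {X : Type*} [MeasurableSpace X] {ν : Measure X} {f : X → ℝ}
    (hf : Integrable f ν) : extExpectation ν f = ((∫ x, f x ∂ν : ℝ) : EReal) := by
  have h1 : ∫⁻ x, ENNReal.ofReal (f x) ∂ν ≠ ⊤ := (Integrable.lintegral_lt_top hf).ne
  have h2 : ∫⁻ x, ENNReal.ofReal (-f x) ∂ν ≠ ⊤ := (Integrable.lintegral_lt_top hf.neg).ne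
  rw [extExpectation, if_neg h1, integral_eq_lintegral_pos_part_sub_lintegral_neg_part hf,
    EReal.coe_sub, EReal.coe_ennreal_toReal h1, EReal.coe_ennreal_toReal h2]

/-- All components use the same transfers, so payments depend on the posterior alone and only its
overall law matters for the cost. -/
theorem extExpectation_compProd_snd {X Y : Type*} [MeasurableSpace X] [MeasurableSpace Y]
    (ν : Measure X) [SFinite ν] (η : Kernel X Y) [IsSFiniteKernel η] {f : Y → ℝ}
    (hf : Measurable f) :
    extExpectation (ν.compProd η) (fun p => f p.2) = extExpectation (ν.bind η) f := by
  have h : ∀ g : Y → ℝ≥0∞, Measurable g →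
      ∫⁻ p : X × Y, g p.2 ∂(ν.compProd η) = ∫⁻ y, g y ∂(ν.bind η) := by
    intro g hg
    rw [← Measure.snd_compProd, Measure.snd, lintegral_map hg measurable_snd]
  simp only [extExpectation]
  rw [h _ hf.ennreal_ofReal, h (fun y => ENNReal.ofReal (-f y)) hf.neg.ennreal_ofReal]

namespace Environment

variable {Θ : Type u} [Fintype Θ] {A : Type w} [TopologicalSpace A]

theorem ordConnected_image_v (E : Environment Θ A) : (E.v '' E.money).OrdConnected :=
  (E.money_interval.isPreconnected.image _ E.v_contDiff.continuousOn).ordConnected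

theorem monotoneOn_vInv (E : Environment Θ A) : MonotoneOn E.vInv (E.v '' E.money) := by
  intro a ha b hb hab
  rw [vInv, ← E.v_strictMono.le_iff_le (Function.invFunOn_mem ha) (Function.invFunOn_mem hb),
    Function.invFunOn_eq ha, Function.invFunOn_eq hb]
  exact hab

theorem measurable_vInv (E : Environment Θ A) : Measurable E.vInv := by
  refine measurable_of_restrict_of_restrict_compl E.ordConnected_image_v.measurableSet ?_ ?_
  · exact Monotone.measurable fun a b hab => E.monotoneOn_vInv a.2 b.2 hab
  -- Off the range of `v`, `Function.invFunOn` takes a constant default value.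
  · have h : (E.v '' E.money)ᶜ.domRestrict E.vInv =
        fun _ => Classical.choice (inferInstance : Nonempty ℝ) :=
      funext fun a => Function.invFunOn_neg a.2
    rw [h]
    exact measurable_const

theorem measurable_payment (E : Environment Θ A) (K : Contract Θ) : Measurable (E.payment K) :=
  Finset.measurable_sum _ fun θ _ =>
    (measurable_belief_apply θ).mul (E.measurable_vInv.comp (K.transfer_measurable θ))

theorem exists_abs_sum_util_le [CompactSpace A] (E : Environment Θ A) :
    ∃ B, ∀ (a : A) (x : Belief Θ), |∑ θ, x.1 θ * E.util a θ| ≤ B := by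
  have h : ∀ θ, ∃ B, ∀ a, |E.util a θ| ≤ B := by
    intro θ
    obtain ⟨B, hB⟩ := (isCompact_range (E.util_continuous θ).abs).bddAbove
    exact ⟨B, fun a => hB ⟨a, rfl⟩⟩
  choose B hB using h
  refine ⟨∑ θ, B θ, fun a x => (Finset.abs_sum_le_sum_abs _ _).trans
    (Finset.sum_le_sum fun θ _ => ?_)⟩
  have h1 : x.1 θ ≤ 1 := by
    rw [← x.2.2]
    exact Finset.single_le_sum (fun i _ => x.2.1 i) (Finset.mem_univ θ)
  rw [abs_mul, abs_of_nonneg (x.2.1 θ)]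
  exact (mul_le_of_le_one_left (abs_nonneg _) h1).trans (hB θ a)

theorem measurable_grossValue [CompactSpace A] (E : Environment Θ A) :
    Measurable E.grossValue := by
  obtain ⟨B, hB⟩ := E.exists_abs_sum_util_le
  refine (lowerSemicontinuous_ciSup (fun x => ⟨B, ?_⟩) fun a => ?_).measurable
  · rintro _ ⟨a, rfl⟩
    exact (abs_le.1 (hB a x)).2
  · exact Continuous.lowerSemicontinuous
      (continuous_finsetSum _ fun θ _ => (continuous_belief_apply θ).mul continuous_const)

theorem integrable_grossValue [CompactSpace A] [Nonempty A] (E : Environment Θ A)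
    (F : Measure (Belief Θ)) [IsFiniteMeasure F] : Integrable E.grossValue F := by
  obtain ⟨B, hB⟩ := E.exists_abs_sum_util_le
  refine Integrable.of_bound E.measurable_grossValue.aestronglyMeasurable B (ae_of_all _ fun x => ?_)
  obtain ⟨a⟩ := ‹Nonempty A›
  have : Nonempty A := ⟨a⟩
  rw [Real.norm_eq_abs, abs_le]
  refine ⟨?_, ciSup_le fun a => (abs_le.1 (hB a x)).2⟩
  exact (abs_le.1 (hB a x)).1.trans (le_ciSup (f := fun a => ∑ θ, x.1 θ * E.util a θ)
    ⟨B, by rintro _ ⟨a, rfl⟩; exact (abs_le.1 (hB a x)).2⟩ a)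

end Environment

variable {Θ : Type u} [Fintype Θ] {A : Type w} [TopologicalSpace A]

/-- The contract with the same transfers whose messages are the points of the support of `F`. -/
def Contract.restrictTo (K : Contract Θ) (F : Measure (Belief Θ)) : Contract Θ where
  messages := F.support
  messages_compact := Measure.isClosed_support.isCompact
  transfer := K.transfer
  transfer_measurable := K.transfer_measurable

namespace Environment

/-- If a contract implements `G`, then `G` is a mixture of distributions supported on at most `|Θ|`
points that are implemented by the same transfers. -/
theorem Implements.exists_mixture {E : Environment Θ A} {K : Contract Θ} {G : Measure (Belief Θ)}
    (h : E.Implements K G) :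
    ∃ Λ : Measure (Splitting Θ), IsProbabilityMeasure Λ ∧
      (∀ᵐ ω ∂Λ, E.Implements (K.restrictTo (splitKernel Θ ω)) (splitKernel Θ ω)) ∧
      Λ.bind (splitKernel Θ) = G := by
  obtain ⟨l, hl⟩ := h.exists_supports
  obtain ⟨hK, hm, ⟨⟨hG, -⟩, -⟩, -⟩ := h
  have := hG.1
  obtain ⟨Λ, hΛ, hmean, rfl⟩ := exists_mixture_of_splittings E.prior E.prior_pos G hG.2
  refine ⟨Λ, hΛ, ?_, rfl⟩
  -- Almost every component lives on the closed support of `G`, so its messages were already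
  -- available and its incentive constraints are inherited.
  have hsupp := Measure.ae_ae_of_ae_comp (Measure.support_mem_ae (μ := Λ.bind (splitKernel Θ)))
  filter_upwards [hmean, Measure.ae_ae_of_ae_comp hl.eq_ae, hsupp] with ω h1 h2 h3
  have h4 : (splitKernel Θ ω).support ⊆ K.messages := by
    rw [hm]
    exact Measure.support_subset_of_isClosed Measure.isClosed_support h3
  refine Supports.implements (l := l) ⟨fun m hm' => hl.transfer_le m (h4 hm'), hl.outside_le, h2⟩
    (fun m hm' => hK m (h4 hm')) rfl ⟨inferInstance, fun θ => ?_⟩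
  rw [integral_splitKernel, h1]

/-- Distributions supported on at most `|Θ|` points suffice for randomizations. -/
theorem Implements.exists_randomContract {E : Environment Θ A} {K : Contract Θ}
    {G : Measure (Belief Θ)} (h : E.Implements K G) :
    ∃ R : RandomContract Θ, R.Induces E G ∧ R.SmallSupport ∧ R.cost E = E.cost K G := by
  obtain ⟨Λ, hΛ, himp, hbind⟩ := h.exists_mixture
  refine ⟨{ Ω := Splitting Θ
            prob := Λ
            contract := fun ω => K.restrictTo (splitKernel Θ ω)
            transfer_measurable := fun θ => (K.transfer_measurable θ).comp measurable_snd
            dist := splitKernel Θ }, ⟨himp, hbind⟩,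
    ae_of_all _ support_splitKernel_encard_le, ?_⟩
  rw [cost, ← hbind, ← extExpectation_compProd_snd Λ (splitKernel Θ) (E.measurable_payment K)]
  rfl

/-- Distributions supported on at most `|Θ|` points suffice for deterministic contracts. -/
theorem Implements.exists_principalPayoff_ge [CompactSpace A] [Nonempty A]
    {E : Environment Θ A} {K : Contract Θ} {G : Measure (Belief Θ)} (h : E.Implements K G)
    {r : ℝ} (hr : (r : EReal) ≤ E.principalPayoff K G) :
    ∃ (F : Measure (Belief Θ)) (K' : Contract Θ), E.Implements K' F ∧
      F.support.encard ≤ Fintype.card Θ ∧ (r : EReal) ≤ E.principalPayoff K' F := by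
  by_contra! hcon
  obtain ⟨Λ, hΛ, himp, hbind⟩ := h.exists_mixture
  have hG : IsProbabilityMeasure G := h.2.2.1.1.1.1
  set pay := E.payment K
  have hpm : Measurable pay := E.measurable_payment K
  -- The shortfall from `r`: its mean is positive under almost every component, by contradiction
  -- hypothesis, and must be shown positive under `G`.
  set q : Belief Θ → ℝ := fun x => r - E.grossValue x + pay x with hq
  have hqm : Measurable q := (measurable_const.sub E.measurable_grossValue).add hpm
  have hrV : Integrable (fun x => r - E.grossValue x) G :=
    (integrable_const r).sub (E.integrable_grossValue G)
  have hlt : ∀ᵐ ω ∂Λ, ∫⁻ x, ENNReal.ofReal (-q x) ∂(splitKernel Θ ω) <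
      ∫⁻ x, ENNReal.ofReal (q x) ∂(splitKernel Θ ω) := by
    filter_upwards [himp] with ω hω
    have h1 := hcon _ _ hω (support_splitKernel_encard_le ω)
    have hint := integrable_splitKernel ω
    have h2 : E.cost (K.restrictTo (splitKernel Θ ω)) (splitKernel Θ ω) =
        ((∫ x, pay x ∂(splitKernel Θ ω) : ℝ) : EReal) := extExpectation_eq_integral (hint pay)
    rw [principalPayoff, h2, ← EReal.coe_sub, EReal.coe_lt_coe_iff] at h1
    have h3 : 0 < ∫ x, q x ∂(splitKernel Θ ω) := by
      rw [hq, integral_add (hint _) (hint _), integral_sub (hint _) (hint _), integral_const,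
        probReal_univ, one_smul]
      linarith
    rw [integral_eq_lintegral_pos_part_sub_lintegral_neg_part (hint q), sub_pos] at h3
    exact (ENNReal.toReal_lt_toReal (Integrable.lintegral_lt_top (hint q).neg).ne
      (Integrable.lintegral_lt_top (hint q)).ne).1 h3
  have hbi : ∀ g : Belief Θ → ℝ≥0∞, Measurable g →
      ∫⁻ x, g x ∂G = ∫⁻ ω, ∫⁻ x, g x ∂(splitKernel Θ ω) ∂Λ := by
    intro g hg
    rw [← hbind, Measure.lintegral_bind (Kernel.aemeasurable _) hg.aemeasurable]
  have hcost : ∫⁻ x, ENNReal.ofReal (pay x) ∂G ≠ ⊤ := by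
    intro htop
    have : E.cost K G = ⊤ := by rw [cost, extExpectation, if_pos htop]
    rw [principalPayoff, this, EReal.sub_top, le_bot_iff] at hr
    exact EReal.coe_ne_bot r hr
  have hq1 : ∫⁻ x, ENNReal.ofReal (q x) ∂G ≠ ⊤ := by
    refine ne_top_of_le_ne_top (ENNReal.add_ne_top.2
      ⟨(Integrable.lintegral_lt_top hrV).ne, hcost⟩) ?_
    rw [← lintegral_add_right _ hpm.ennreal_ofReal]
    exact lintegral_mono fun x => ENNReal.ofReal_add_le
  -- Payments need not be integrable a priori. The positive part of `q` is controlled by the cost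
  -- not being `⊤`, and the negative part is dominated by it component by component.
  have hq2 : ∫⁻ x, ENNReal.ofReal (-q x) ∂G ≠ ⊤ := by
    refine ne_top_of_le_ne_top hq1 ?_
    rw [hbi _ hqm.ennreal_ofReal, hbi (fun x => ENNReal.ofReal (-q x)) hqm.neg.ennreal_ofReal]
    exact lintegral_mono_ae (hlt.mono fun _ h => h.le)
  have hqlt : ∫⁻ x, ENNReal.ofReal (-q x) ∂G < ∫⁻ x, ENNReal.ofReal (q x) ∂G := by
    rw [hbi _ hqm.ennreal_ofReal]
    rw [hbi (fun x => ENNReal.ofReal (-q x)) hqm.neg.ennreal_ofReal] at hq2 ⊢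
    exact lintegral_strict_mono (IsProbabilityMeasure.ne_zero Λ)
      (hqm.ennreal_ofReal.lintegral_kernel).aemeasurable hq2 hlt
  have hqi : Integrable q G := by
    refine ⟨hqm.aestronglyMeasurable, ?_⟩
    rw [hasFiniteIntegral_iff_norm]
    refine lt_of_le_of_lt (lintegral_mono (g := fun x => ENNReal.ofReal (q x) +
      ENNReal.ofReal (-q x)) fun x => ?_) ?_
    · rw [Real.norm_eq_abs]
      rcases le_total 0 (q x) with h0 | h0
      · rw [abs_of_nonneg h0]
        exact le_self_add
      · rw [abs_of_nonpos h0]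
        exact le_add_self
    · rw [lintegral_add_left hqm.ennreal_ofReal]
      exact ENNReal.add_lt_top.2 ⟨hq1.lt_top, hq2.lt_top⟩
  have hpi : Integrable pay G := (hqi.sub hrV).congr (ae_of_all _ fun x => by simp [hq])
  have hpos : 0 < ∫ x, q x ∂G := by
    rw [integral_eq_lintegral_pos_part_sub_lintegral_neg_part hqi, sub_pos]
    exact (ENNReal.toReal_lt_toReal hq2 hq1).2 hqlt
  rw [hq, integral_add hrV hpi, integral_sub (integrable_const r) (E.integrable_grossValue G),
    integral_const, probReal_univ, one_smul] at hpos
  have h2 : E.cost K G = ((∫ x, pay x ∂G : ℝ) : EReal) := extExpectation_eq_integral hpi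
  rw [principalPayoff, h2, ← EReal.coe_sub, EReal.coe_le_coe_iff] at hr
  linarith

end Environment

end Mixture

/-! ### Tangent contracts for interior distributions -/

section InteriorDistributions

open Filter Topology

variable {Θ : Type u} [Fintype Θ] {A : Type w} [TopologicalSpace A]

namespace Environment

theorem add_smul_mem_openSimplex {x y : Θ → ℝ} (hx : x ∈ openSimplex Θ) (hy : y ∈ stdSimplex ℝ Θ)
    {s : ℝ} (hs0 : 0 ≤ s) (hs1 : s < 1) : x + s • (y - x) ∈ openSimplex Θ := by
  have h : x + s • (y - x) = (1 - s) • x + s • y := by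
    ext θ
    simp only [Pi.add_apply, Pi.smul_apply, Pi.sub_apply, smul_eq_mul]
    ring
  rw [h]
  refine ⟨convex_stdSimplex ℝ Θ hx.1 hy (by linarith) hs0 (by ring), fun θ => ?_⟩
  have h1 := mul_pos (sub_pos.2 hs1) (hx.2 θ)
  have h2 := mul_nonneg hs0 (hy.1 θ)
  simp only [Pi.add_apply, Pi.smul_apply, smul_eq_mul]
  linarith

/-- The derivative of the cost of information is the limit of difference quotients along segments
to points of the simplex. -/
theorem tendsto_differenceQuotient (E : Environment Θ A) {x y : Θ → ℝ} (hx : x ∈ openSimplex Θ)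
    (hy : y ∈ stdSimplex ℝ Θ) :
    Tendsto (fun k : ℕ => ((k : ℝ) + 1) * (E.c (x + (1 / ((k : ℝ) + 1)) • (y - x)) - E.c x)) atTop
      (𝓝 (fderivWithin ℝ E.c (openSimplex Θ) x (y - x))) := by
  -- The open simplex is not open in `Θ → ℝ`, but the derivative within it is determined along
  -- segments that stay inside. The index `k = 0` is dropped below because it reaches `y`, possibly
  -- on the boundary.
  have hd := ((E.c_contDiff x hx).differentiableWithinAt (by simp)).hasFDerivWithinAt
  refine hd.lim (c := fun k : ℕ => (k : ℝ) + 1) ?_ ?_ ?_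
  · simpa using (tendsto_one_div_add_atTop_nhds_zero_nat (𝕜 := ℝ)).smul_const (y - x)
  · filter_upwards [eventually_ge_atTop 1] with k hk
    have hk' : (1 : ℝ) ≤ k := by exact_mod_cast hk
    refine add_smul_mem_openSimplex hx hy (by positivity) ?_
    rw [div_lt_one (by positivity)]
    linarith
  · refine tendsto_const_nhds.congr fun k => ?_
    rw [smul_smul, mul_one_div_cancel (by positivity), one_smul]

/-- The tangent of the cost of information at an interior belief lies below it on the simplex. -/
theorem add_fderivWithin_le (E : Environment Θ A) {x y : Θ → ℝ} (hx : x ∈ openSimplex Θ)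
    (hy : y ∈ stdSimplex ℝ Θ) :
    E.c x + fderivWithin ℝ E.c (openSimplex Θ) x (y - x) ≤ E.c y := by
  have h := le_of_tendsto (E.tendsto_differenceQuotient hx hy) (b := E.c y - E.c x)
    (Eventually.of_forall fun k => by
      have hk : (0 : ℝ) < (k : ℝ) + 1 := by positivity
      have hle : 1 / ((k : ℝ) + 1) ≤ 1 := by
        rw [div_le_one hk]
        linarith [k.cast_nonneg (α := ℝ)]
      have hc := E.c_strictConvex.convexOn.2 hx.1 hy (sub_nonneg.2 hle)
        (one_div_pos.2 hk).le (by ring)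
      have e : (1 - 1 / ((k : ℝ) + 1)) • x + (1 / ((k : ℝ) + 1)) • y =
          x + (1 / ((k : ℝ) + 1)) • (y - x) := by
        ext θ
        simp only [Pi.add_apply, Pi.smul_apply, Pi.sub_apply, smul_eq_mul]
        ring
      rw [e, smul_eq_mul, smul_eq_mul] at hc
      calc ((k : ℝ) + 1) * (E.c (x + (1 / ((k : ℝ) + 1)) • (y - x)) - E.c x)
          ≤ ((k : ℝ) + 1) * (1 / ((k : ℝ) + 1) * (E.c y - E.c x)) :=
            mul_le_mul_of_nonneg_left (by linarith) hk.le
        _ = E.c y - E.c x := by field_simp)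
  linarith

/-- Directional derivative of the cost of information at an interior belief, towards the vertex
of the state `θ`. -/
def vertexDeriv (E : Environment Θ A) (θ : Θ) (x : Belief Θ) : ℝ :=
  open Classical in
  if x.1 ∈ openSimplex Θ then
    fderivWithin ℝ E.c (openSimplex Θ) x.1 (Pi.single θ 1 - x.1)
  else 0

theorem measurableSet_openSimplex : MeasurableSet {x : Belief Θ | x.1 ∈ openSimplex Θ} := by
  have h : {x : Belief Θ | x.1 ∈ openSimplex Θ} = ⋂ θ, {x : Belief Θ | 0 < x.1 θ} := by
    ext x
    simp only [openSimplex, Set.mem_ofPred_eq, Set.mem_iInter]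
    exact ⟨fun hx => hx.2, fun hx => ⟨x.2, hx⟩⟩
  rw [h]
  exact MeasurableSet.iInter fun θ => measurableSet_lt measurable_const (measurable_belief_apply θ)

/-- On the interior it is a pointwise limit of measurable difference quotients, so only
measurability of `c` is needed. -/
theorem measurable_vertexDeriv (E : Environment Θ A) (θ : Θ) : Measurable (E.vertexDeriv θ) := by
  classical
  let y : ℕ → Belief Θ → Belief Θ := fun k x =>
    ⟨x.1 + (1 / ((k : ℝ) + 1)) • (Pi.single θ 1 - x.1), by
      have hk : (0 : ℝ) < (k : ℝ) + 1 := by positivity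
      have hle : 1 / ((k : ℝ) + 1) ≤ 1 := by
        rw [div_le_one hk]
        linarith [k.cast_nonneg (α := ℝ)]
      exact (convex_stdSimplex ℝ Θ).add_smul_sub_mem x.2 (single_mem_stdSimplex ℝ θ)
        ⟨(one_div_pos.2 hk).le, hle⟩⟩
  have hy : ∀ k, Measurable (y k) := fun k =>
    Measurable.subtype_mk (f := fun x : Belief Θ =>
      x.1 + (1 / ((k : ℝ) + 1)) • (Pi.single θ 1 - x.1)) (by fun_prop)
  refine measurable_of_tendsto_metrizable (f := fun (k : ℕ) (x : Belief Θ) =>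
    if x.1 ∈ openSimplex Θ then ((k : ℝ) + 1) * (E.c (y k x).1 - E.c x.1) else 0) ?_ ?_
  · intro k
    exact Measurable.ite measurableSet_openSimplex
      (((E.c_measurable.comp (hy k)).sub E.c_measurable).const_mul _) measurable_const
  · rw [tendsto_pi_nhds]
    intro x
    by_cases hx : x.1 ∈ openSimplex Θ
    · simp only [vertexDeriv, if_pos hx]
      convert E.tendsto_differenceQuotient hx (single_mem_stdSimplex ℝ θ)
    · simp only [vertexDeriv, if_neg hx]
      exact tendsto_const_nhds

/-- Since `y` sums to one, `y - x` is the `y`-weighted sum of the directions to the vertices. This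
lets state-contingent transfers reproduce a tangent. -/
theorem sum_mul_vertexDeriv (E : Environment Θ A) {x : Belief Θ} (hx : x.1 ∈ openSimplex Θ)
    (y : Belief Θ) :
    ∑ θ, y.1 θ * E.vertexDeriv θ x = fderivWithin ℝ E.c (openSimplex Θ) x.1 (y.1 - x.1) := by
  classical
  have h : y.1 - x.1 = ∑ θ, y.1 θ • (Pi.single θ 1 - x.1) := by
    simp_rw [smul_sub]
    rw [Finset.sum_sub_distrib, ← Finset.sum_smul, y.2.2, one_smul]
    congr 1
    ext ϑ
    simp [Finset.sum_apply, Pi.single_apply]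
  rw [h, map_sum]
  refine Finset.sum_congr rfl fun θ _ => ?_
  rw [map_smul, smul_eq_mul, vertexDeriv, if_pos hx]

theorem add_vertexDeriv_le (E : Environment Θ A) {x : Belief Θ} (hx : x.1 ∈ openSimplex Θ) {B : ℝ}
    (hB : ∀ x : Belief Θ, E.c x.1 ≤ B) (θ : Θ) : E.c x.1 + E.vertexDeriv θ x ≤ B := by
  classical
  refine le_trans ?_ (hB ⟨Pi.single θ 1, single_mem_stdSimplex ℝ θ⟩)
  rw [vertexDeriv, if_pos hx]
  convert E.add_fderivWithin_le hx (single_mem_stdSimplex ℝ θ)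

theorem le_add_vertexDeriv (E : Environment Θ A) {x : Belief Θ} (hx : x.1 ∈ openSimplex Θ) {B : ℝ}
    (hB : ∀ x : Belief Θ, E.c x.1 ≤ B) {δ : ℝ} (hδ : 0 < δ) (θ : Θ) (hδx : δ ≤ x.1 θ) :
    -(B / δ) ≤ E.c x.1 + E.vertexDeriv θ x := by
  classical
  -- Moving away from the vertex lowers only coordinate `θ`, by at most `δ ≤ x θ`. The tangent
  -- inequality at this point bounds the slope towards the vertex from below.
  have hy : x.1 + δ • (x.1 - Pi.single θ 1) ∈ stdSimplex ℝ Θ := by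
    refine ⟨fun ϑ => ?_, ?_⟩
    · have h0 := x.2.1 ϑ
      simp only [Pi.add_apply, Pi.smul_apply, Pi.sub_apply, smul_eq_mul]
      by_cases hϑ : ϑ = θ
      · subst hϑ
        rw [Pi.single_eq_same]
        have := mul_nonneg hδ.le h0
        linarith
      · rw [Pi.single_eq_of_ne hϑ]
        have := mul_nonneg hδ.le h0
        linarith
    · simp [Finset.sum_add_distrib, ← Finset.mul_sum, Finset.sum_sub_distrib, x.2.2]
  have h := E.add_fderivWithin_le hx hy
  have e : x.1 + δ • (x.1 - Pi.single θ 1) - x.1 = -(δ • (Pi.single θ 1 - x.1)) := by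
    rw [add_sub_cancel_left, ← smul_neg, neg_sub]
  rw [e, map_neg, map_smul, smul_eq_mul] at h
  have hd : E.vertexDeriv θ x =
      fderivWithin ℝ E.c (openSimplex Θ) x.1 (Pi.single θ 1 - x.1) := by
    rw [vertexDeriv, if_pos hx]
  rw [← hd] at h
  have h1 := hB ⟨_, hy⟩
  have h0 := E.c_nonneg x.1 x.2
  rw [neg_le, div_eq_inv_mul, ← sub_nonneg]
  rw [← sub_nonneg]
  have h2 : -(E.vertexDeriv θ x) ≤ δ⁻¹ * B := by
    rw [← div_eq_inv_mul, le_div_iff₀ hδ]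
    simp only at h1
    linarith
  linarith

theorem exists_pos_le_of_support (F : Measure (Belief Θ))
    (hF : ∀ x ∈ F.support, x.1 ∈ openSimplex Θ) :
    ∃ δ : ℝ, 0 < δ ∧ ∀ x ∈ F.support, ∀ θ, δ ≤ x.1 θ := by
  have h : ∀ θ, ∃ δ : ℝ, 0 < δ ∧ ∀ x ∈ F.support, δ ≤ x.1 θ := by
    intro θ
    rcases F.support.eq_empty_or_nonempty with he | hne
    · exact ⟨1, one_pos, by simp [he]⟩
    · obtain ⟨x, hx, hmin⟩ := Measure.isClosed_support.isCompact.exists_isMinOn hne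
        (continuous_belief_apply θ).continuousOn
      exact ⟨x.1 θ, (hF x hx).2 θ, fun y hy => hmin hy⟩
  choose δ hδ hle using h
  rcases isEmpty_or_nonempty Θ with hΘ | hΘ
  · exact ⟨1, one_pos, fun _ _ θ => hΘ.elim θ⟩
  · refine ⟨Finset.univ.inf' Finset.univ_nonempty δ, ?_, fun x hx θ => ?_⟩
    · rw [Finset.lt_inf'_iff]
      exact fun θ _ => hδ θ
    · exact (Finset.inf'_le _ (Finset.mem_univ θ)).trans (hle θ x hx)

/-- The contract that pays, for each message, a tangent of the cost of information. -/
def tangentContract (E : Environment Θ A) (L : ℝ) (F : Measure (Belief Θ)) : Contract Θ where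
  messages := F.support
  messages_compact := Measure.isClosed_support.isCompact
  transfer m θ := L + E.kappa * (E.c m.1 + E.vertexDeriv θ m)
  transfer_measurable θ :=
    ((E.c_measurable.add (E.measurable_vertexDeriv θ)).const_mul _).const_add _

theorem sum_mul_transfer_tangentContract (E : Environment Θ A) (L : ℝ) (F : Measure (Belief Θ))
    {m : Belief Θ} (hm : m.1 ∈ openSimplex Θ) (x : Belief Θ) :
    ∑ θ, x.1 θ * (E.tangentContract L F).transfer m θ =
      L + E.kappa * (E.c m.1 + fderivWithin ℝ E.c (openSimplex Θ) m.1 (x.1 - m.1)) := by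
  rw [← E.sum_mul_vertexDeriv hm]
  have h : ∀ θ, x.1 θ * (E.tangentContract L F).transfer m θ =
      x.1 θ * (L + E.kappa * E.c m.1) + E.kappa * (x.1 θ * E.vertexDeriv θ m) := by
    intro θ
    simp only [tangentContract]
    ring
  simp_rw [h]
  rw [Finset.sum_add_distrib, ← Finset.sum_mul, ← Finset.mul_sum, x.2.2]
  ring

/-- If the agent's utility is unbounded above, every distribution supported in the interior of the
simplex can be implemented at a finite cost. -/
theorem exists_implements_of_interior (E : Environment Θ A) (hv : ¬ BddAbove (E.v '' E.money))
    {F : Measure (Belief Θ)} (hF : E.BayesPlausible F)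
    (hint : ∀ x ∈ F.support, x.1 ∈ openSimplex Θ) :
    ∃ K : Contract Θ, E.Implements K F ∧ ∃ r : ℝ, E.cost K F = r := by
  have := hF.1
  obtain ⟨B, hB⟩ := E.exists_c_le
  obtain ⟨δ, hδ, hδx⟩ := exists_pos_le_of_support F hint
  have hκ := E.kappa_pos
  have hout := E.outside_nonneg
  have hB0 : 0 ≤ B := (E.c_nonneg _ E.prior.2).trans (hB E.prior)
  -- The second term offsets the steepest tangent, so transfers are nonnegative; the first covers
  -- the outside option.
  set L : ℝ := E.outside + E.kappa * (B / δ) with hL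
  set K := E.tangentContract L F with hK
  have hlow : ∀ m ∈ F.support, ∀ θ, 0 ≤ K.transfer m θ := by
    intro m hm θ
    have := mul_le_mul_of_nonneg_left
      (E.le_add_vertexDeriv (hint m hm) hB hδ θ (hδx m hm θ)) hκ.le
    simp only [hK, tangentContract, hL]
    linarith
  have hup : ∀ m ∈ F.support, ∀ θ, K.transfer m θ ≤ L + E.kappa * B := by
    intro m hm θ
    have := mul_le_mul_of_nonneg_left (E.add_vertexDeriv_le (hint m hm) hB θ) hκ.le
    simp only [hK, tangentContract]
    linarith
  -- As `v` is unbounded above and its range is an interval containing `0`, every transfer, lying in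
  -- `[0, T]`, is a feasible utility level with bounded payment.
  obtain ⟨T, hT, hLT⟩ : ∃ T ∈ E.v '' E.money, L + E.kappa * B < T := by
    by_contra! hcon
    exact hv ⟨_, hcon⟩
  have h0 : (0 : ℝ) ∈ E.v '' E.money := ⟨0, E.zero_mem_money, E.v_zero⟩
  have hmem : ∀ m ∈ F.support, ∀ θ, K.transfer m θ ∈ E.v '' E.money := fun m hm θ =>
    E.ordConnected_image_v.out h0 hT ⟨hlow m hm θ, (hup m hm θ).trans hLT.le⟩
  refine ⟨K, ?_, ?_⟩
  · refine Supports.implements (l := fun _ => L) ⟨?_, ?_, ?_⟩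
      (fun m hm θ => ⟨hmem m hm θ, fun _ => hlow m hm θ⟩) rfl hF
    · intro m hm x
      rw [E.sum_mul_transfer_tangentContract L F (hint m hm), ← Finset.sum_mul, x.2.2, one_mul]
      have := mul_le_mul_of_nonneg_left (E.add_fderivWithin_le (hint m hm) x.2) hκ.le
      linarith
    · intro x
      rw [← Finset.sum_mul, x.2.2, one_mul, hL]
      have h1 := mul_nonneg hκ.le (E.c_nonneg x.1 x.2)
      have h2 := mul_nonneg hκ.le (div_nonneg hB0 hδ.le)
      linarith
    · filter_upwards [F.support_mem_ae] with x hx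
      rw [E.sum_mul_transfer_tangentContract L F (hint x hx), ← Finset.sum_mul, x.2.2, one_mul,
        sub_self, map_zero, add_zero]
  · refine ⟨_, extExpectation_eq_integral (Integrable.of_bound
      (E.measurable_payment K).aestronglyMeasurable (max |E.vInv 0| |E.vInv T|) ?_)⟩
    filter_upwards [F.support_mem_ae] with x hx
    rw [Real.norm_eq_abs, payment]
    calc |∑ θ, x.1 θ * E.vInv (K.transfer x θ)|
        ≤ ∑ θ, |x.1 θ * E.vInv (K.transfer x θ)| := Finset.abs_sum_le_sum_abs _ _
      _ ≤ ∑ θ, x.1 θ * max |E.vInv 0| |E.vInv T| := by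
          refine Finset.sum_le_sum fun θ _ => ?_
          rw [abs_mul, abs_of_nonneg (x.2.1 θ)]
          refine mul_le_mul_of_nonneg_left (abs_le_max_abs_abs ?_ ?_) (x.2.1 θ)
          · exact E.monotoneOn_vInv h0 (hmem x hx θ) (hlow x hx θ)
          · exact E.monotoneOn_vInv (hmem x hx θ) hT ((hup x hx θ).trans hLT.le)
      _ = max |E.vInv 0| |E.vInv T| := by rw [← Finset.sum_mul, x.2.2, one_mul]

end Environment

end InteriorDistributions

end Delegation

end

theorem corollary3p1 {Θ : Type u} [Fintype Θ] {A : Type w} [TopologicalSpace A] [CompactSpace A]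
    [Nonempty A] (E : Delegation.Environment Θ A) :
    -- (i) interior distributions can be induced at finite cost
    (¬ BddAbove (E.v '' E.money) →
      ∀ F : Measure (Delegation.Belief Θ), E.BayesPlausible F →
        (∀ x ∈ F.support, x.1 ∈ Delegation.openSimplex Θ) →
        (∃ K : Delegation.Contract Θ, E.Implements K F ∧ ∃ r : ℝ, E.cost K F = r) ∧
        (∃ R : Delegation.RandomContract Θ, R.Induces E F ∧ R.SmallSupport ∧
          ∃ r : ℝ, R.cost E = r)) ∧
    -- (ii) distributions supported on at most `|Θ|` points suffice
    (∀ (G : Measure (Delegation.Belief Θ)) (K : Delegation.Contract Θ), E.Implements K G →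
      (∃ R : Delegation.RandomContract Θ, R.Induces E G ∧ R.SmallSupport ∧
        R.cost E ≤ E.cost K G) ∧
      (∀ r : ℝ, (r : EReal) ≤ E.principalPayoff K G →
        ∃ (F : Measure (Delegation.Belief Θ)) (K' : Delegation.Contract Θ),
          E.Implements K' F ∧ F.support.encard ≤ Fintype.card Θ ∧
          (r : EReal) ≤ E.principalPayoff K' F)) := by
  refine ⟨fun hv F hF hint => ?_, fun G K h => ⟨?_, fun r hr => h.exists_principalPayoff_ge hr⟩⟩
  · obtain ⟨K, hK, r, hr⟩ := E.exists_implements_of_interior hv hF hint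
    obtain ⟨R, h1, h2, h3⟩ := hK.exists_randomContract
    exact ⟨⟨K, hK, r, hr⟩, R, h1, h2, r, h3.trans hr⟩
  · obtain ⟨R, h1, h2, h3⟩ := h.exists_randomContract
    exact ⟨R, h1, h2, h3.le⟩
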